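/- Let $\Gamma$ be a simplicial graph with finite vertex set $I$. For each $i\in I$ let $(W_i,S_i)$ be a Coxeter system, let $\mathcal B_i$ be a finite building of type $(W_i,S_i)$, and let $G_i=\mathrm{Aut}(\mathcal B_i)$ be its group of type-preserving automorphisms, acting on the set of chambers of $\mathcal B_i$. Let $E_i$ be the set of chambers of $\mathcal B_i$, regarded as a rank one building, and let $E=\prod_{i\in I}E_i$. Let $K$ be the Davis chamber of the right-angled Coxeter group $W_\Gamma$ associated to $\Gamma$ (generators $I$; $ij$ has order $2$ if $\{i,j\}$ is an edge and infinite order if $i\ne j$ is a non-edge), and let $\mathcal U(E,K)$ be the realization of $E$ with chamber $K$, that is, the geometric realization of the poset of pairs $(T,R)$, where $T\subseteq I$ generates a finite subgroup of $W_\Gamma$ and $R\subseteq E$ is a $T$-residue. The graph product $\widetilde E=\prod_\Gamma E_i$ is the set of copies of $K$ in the universal cover of $\mathcal U(E,K)$, two copies being $i$-equivalent if they share their $i$-mirrors; let $p\colon\widetilde E\to E$ be the projection induced by the covering map. The standard lattice $\widetilde G$ is the group of all lifts to $\widetilde E$ of the coordinatewise action of $\prod_i G_i$ on $E$, i.e.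 of all bijections $g$ of $\widetilde E$ that preserve $i$-equivalence in both directions for every $i$ and satisfy $p\circ g=h\circ p$ for some $h\in\prod_iG_i$. Fix $C=(C_i)_i\in E$ and let $B_i\le G_i$ be the stabilizer of $C_i$. For $T\subseteq I$ let $H_T\le\prod_iG_i$ be the product of the $G_i$ with $i\in T$ and the $B_i$ with $i\notin T$. The generalized graph product $\overline G$ of the $G_i$ over $\Gamma$ is the direct limit, in the category of groups, of the groups $H_T$ along the inclusions, where $T$ runs over the empty set, the vertices and the edges of $\Gamma$. Then the standard lattice $\widetilde G$ is residually finite, and so is the generalized graph product $\overline G$ (for every $C\in E$). -/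

import Mathlib

/-! ### Buildings and their automorphism groups -/

/-- `δ : Δ → Δ → W` makes the set `Δ` of chambers into a building of type `(W, S)`. -/
structure IsBuilding {S W : Type*} [Group W] {M : CoxeterMatrix S} (cs : CoxeterSystem M W)
    {Δ : Type*} (δ : Δ → Δ → W) : Prop where
  nonempty : Nonempty Δ
  eq_one_iff : ∀ C D, δ C D = 1 ↔ C = D
  step : ∀ C D C' s, δ C' C = cs.simple s →
    (δ C' D = cs.simple s * δ C D ∨ δ C' D = δ C D) ∧
    (cs.length (cs.simple s * δ C D) = cs.length (δ C D) + 1 → δ C' D = cs.simple s * δ C D)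
  exists_step : ∀ C D s, ∃ C', δ C' C = cs.simple s ∧ δ C' D = cs.simple s * δ C D

/-- The group of (type preserving) automorphisms of a building: the bijections of the set of
chambers which, in both directions, preserve `s`-adjacency for every `s`. -/
def buildingAut {S W : Type*} [Group W] {M : CoxeterMatrix S} (cs : CoxeterSystem M W)
    {Δ : Type*} (δ : Δ → Δ → W) : Subgroup (Equiv.Perm Δ) where
  carrier := {g | ∀ s C D, δ C D = cs.simple s ↔ δ (g C) (g D) = cs.simple s}
  one_mem' := fun _ _ _ => Iff.rfl
  mul_mem' := fun {a b} ha hb s C D => (hb s C D).trans (ha s (b C) (b D))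
  inv_mem' := fun {a} ha s C D => by
    have h := ha s (a⁻¹ C) (a⁻¹ D)
    simpa using h.symm

/-! ### The combinatorial universal cover of the geometric realization of a poset -/

/-- Edge paths from `a` to `b` in the order complex of a poset `P`, that is, in the simplicial
complex `|P|` whose simplices are the finite nonempty chains. -/
inductive EdgePath {P : Type*} [PartialOrder P] (a : P) : P → Type _
  | nil : EdgePath a a
  | snoc {b c : P} (p : EdgePath a b) (h : b ≤ c ∨ c ≤ b) : EdgePath a c

/-- Elementary homotopies of edge paths: a constant edge may be dropped, and two consecutive
edges `bc`, `cd` may be replaced by `bd` if `b`, `c`, `d` are the vertices of a (possibly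
degenerate) simplex of the order complex. -/
inductive EdgePath.Elementary {P : Type*} [PartialOrder P] {a : P} :
    {b : P} → EdgePath a b → EdgePath a b → Prop
  | stutter {b : P} (p : EdgePath a b) (h : b ≤ b ∨ b ≤ b) : Elementary (p.snoc h) p
  | triangle {b c d : P} (p : EdgePath a b) (hbc : b ≤ c ∨ c ≤ b) (hcd : c ≤ d ∨ d ≤ c)
      (hbd : b ≤ d ∨ d ≤ b) : Elementary ((p.snoc hbc).snoc hcd) (p.snoc hbd)
  | snoc {b c : P} {p q : EdgePath a b} (hpq : Elementary p q) (h : b ≤ c ∨ c ≤ b) :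
      Elementary (p.snoc h) (q.snoc h)

/-- Homotopy classes of edge paths with fixed end points, homotopy being the equivalence relation
generated by the elementary homotopies. -/
def PathClass {P : Type*} [PartialOrder P] (a b : P) : Type _ :=
  Quot (EdgePath.Elementary (a := a) (b := b))

/-- Append an edge to a homotopy class of edge paths. -/
def PathClass.snoc {P : Type*} [PartialOrder P] {a b c : P} (x : PathClass a b)
    (h : b ≤ c ∨ c ≤ b) : PathClass a c :=
  Quot.map (fun p => p.snoc h) (fun _ _ hpq => hpq.snoc h) x

/-- The vertices of the universal cover of (the connected component of `a` in) the order complex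
of `P`: pairs of a vertex `b` and a homotopy class of edge paths from `a` to `b`. -/
def UniversalCover {P : Type*} [PartialOrder P] (a : P) : Type _ := Σ b : P, PathClass a b

/-- The order on the vertices of the universal cover lifted from `P`; the universal cover is its
order complex. -/
def UniversalCover.Below {P : Type*} [PartialOrder P] {a : P} (x y : UniversalCover a) : Prop :=
  ∃ h : x.1 ≤ y.1, y.2 = x.2.snoc (Or.inl h)

/-! ### The graph product of rank one buildings -/

open Classical in
/-- The Coxeter matrix of the right angled Coxeter group associated to a graph
(the entry `0` stands for `∞`). -/
noncomputable def rightAngledMatrix {I : Type*} (Γ : SimpleGraph I) : CoxeterMatrix I where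
  M := fun i j => if i = j then 1 else if Γ.Adj i j then 2 else 0
  isSymm := by
    refine Matrix.IsSymm.ext fun i j => ?_
    simp only [eq_comm (a := j), Γ.adj_comm j]
  diagonal := by simp
  off_diagonal := by
    intro i j h
    simp only [h, if_false]
    split_ifs <;> decide

/-- A set of generators is spherical if it generates a finite subgroup of the right angled
Coxeter group of `Γ`. -/
def IsSpherical {I : Type*} (Γ : SimpleGraph I) (T : Set I) : Prop :=
  Finite (Subgroup.closure ((rightAngledMatrix Γ).simple '' T))

/-- The `T`-residue of the chamber `C` in the product `∏ i, X i` of the rank one buildings `X i`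
(for finite `T`): the chambers which differ from `C` in coordinates from `T` only. -/
def productResidue {I : Type*} {X : I → Type*} (T : Set I) (C : ∀ i, X i) : Set (∀ i, X i) :=
  {D | ∀ i, i ∉ T → D i = C i}

/-- The residues of `∏ i, X i` of spherical type, sphericity being with respect to the right
angled Coxeter group of `Γ`. Ordered by inclusion (of types and of sets of chambers), these form
the poset whose order complex is the realization of the product building `∏ i, X i` with the
Davis chamber of that Coxeter group: the copy of the Davis chamber that belongs to the chamber
`C` has the residues of `C` as its vertices. -/
@[ext]
structure SphericalResidue {I : Type*} (Γ : SimpleGraph I) (X : I → Type*) where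
  type : Set I
  carrier : Set (∀ i, X i)
  spherical : IsSpherical Γ type
  isResidue : ∃ C, carrier = productResidue type C

instance {I : Type*} (Γ : SimpleGraph I) (X : I → Type*) :
    PartialOrder (SphericalResidue Γ X) where
  le R R' := R.type ⊆ R'.type ∧ R.carrier ⊆ R'.carrier
  le_refl R := ⟨subset_rfl, subset_rfl⟩
  le_trans _ _ _ h h' := ⟨h.1.trans h'.1, h.2.trans h'.2⟩
  le_antisymm _ _ h h' :=
    SphericalResidue.ext (h.1.antisymm h'.1) (h.2.antisymm h'.2)

/-- A chamber `C` as the residue of type `∅`, the cone point of the copy of the Davis chamber that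
belongs to `C`. -/
def chamberVertex {I : Type*} (Γ : SimpleGraph I) {X : I → Type*} (C : ∀ i, X i) :
    SphericalResidue Γ X where
  type := ∅
  carrier := productResidue ∅ C
  spherical := by
    unfold IsSpherical
    rw [Set.image_empty, Subgroup.closure_empty]
    infer_instance
  isResidue := ⟨C, rfl⟩

/-- The set of chambers of the graph product over `Γ` of the rank one buildings `X i`, with base
chamber `C₀`: the copies of the Davis chamber in the universal cover of the realization of
`∏ i, X i`, each given by its cone point, a lift of the cone point of a chamber. -/
def GraphProduct {I : Type*} (Γ : SimpleGraph I) {X : I → Type*} (C₀ : ∀ i, X i) : Type _ :=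
  Σ C : (∀ i, X i), PathClass (chamberVertex Γ C₀) (chamberVertex Γ C)

namespace GraphProduct

/-- The projection of the graph product onto the product. -/
def proj {I : Type*} {Γ : SimpleGraph I} {X : I → Type*} {C₀ : ∀ i, X i}
    (x : GraphProduct Γ C₀) : ∀ i, X i := x.1

/-- The cone point of a copy of the Davis chamber, as a vertex of the universal cover. -/
def conePoint {I : Type*} {Γ : SimpleGraph I} {X : I → Type*} {C₀ : ∀ i, X i}
    (x : GraphProduct Γ C₀) : UniversalCover (chamberVertex Γ C₀) :=
  ⟨chamberVertex Γ x.1, x.2⟩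

/-- Two chambers of the graph product are `i`-equivalent (equal or `i`-adjacent) if the
corresponding copies of the Davis chamber share their `i`-mirrors, that is, if they have a common
vertex of type `{i}`. -/
def Equivalent {I : Type*} {Γ : SimpleGraph I} {X : I → Type*} {C₀ : ∀ i, X i} (i : I)
    (x y : GraphProduct Γ C₀) : Prop :=
  ∃ z : UniversalCover (chamberVertex Γ C₀),
    z.1.type = {i} ∧ x.conePoint.Below z ∧ y.conePoint.Below z

end GraphProduct

/-- The standard lattice: the group of all lifts to the graph product of the coordinatewise action
of `∏ i, G i` on `∏ i, X i`. A lift is a type preserving automorphism `g` of the graph product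
which covers the action of some `h ∈ ∏ i, G i`. -/
def liftGroup {I : Type*} (Γ : SimpleGraph I) {X : I → Type*} (G : I → Type*)
    [∀ i, Group (G i)] [∀ i, MulAction (G i) (X i)] (C₀ : ∀ i, X i) :
    Subgroup (Equiv.Perm (GraphProduct Γ C₀)) where
  carrier := {g |
    (∀ i x y, GraphProduct.Equivalent i x y ↔ GraphProduct.Equivalent i (g x) (g y)) ∧
    ∃ h : ∀ i, G i, ∀ x i, (g x).proj i = h i • x.proj i}
  one_mem' := ⟨fun _ _ _ => Iff.rfl, 1, fun x i => by simp⟩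
  mul_mem' := by
    rintro a b ⟨ha, h, hh⟩ ⟨hb, k, hk⟩
    refine ⟨fun i x y => (hb i x y).trans (ha i (b x) (b y)), h * k, fun x i => ?_⟩
    rw [Equiv.Perm.mul_apply, hh, hk, Pi.mul_apply, mul_smul]
  inv_mem' := by
    rintro a ⟨ha, h, hh⟩
    refine ⟨fun i x y => ?_, h⁻¹, fun x i => ?_⟩
    · have := ha i (a⁻¹ x) (a⁻¹ y)
      simpa using this.symm
    · have := hh (a⁻¹ x) i
      rw [← Equiv.Perm.mul_apply, mul_inv_cancel, Equiv.Perm.one_apply] at this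
      rw [this, Pi.inv_apply, inv_smul_smul]

/-! ### The generalized graph product of groups -/

/-- The subgroup of `∏ i, G i` with factor `G i` in the positions `i ∈ T` and the stabilizer of
`C i` in the other positions. -/
def partialStabilizer {I : Type*} {X : I → Type*} (G : I → Type*) [∀ i, Group (G i)]
    [∀ i, MulAction (G i) (X i)] (C : ∀ i, X i) (T : Set I) : Subgroup (∀ i, G i) where
  carrier := {g | ∀ i, i ∉ T → g i ∈ MulAction.stabilizer (G i) (C i)}
  one_mem' := fun _ _ => one_mem _
  mul_mem' := fun ha hb i hi => mul_mem (ha i hi) (hb i hi)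
  inv_mem' := fun ha i hi => inv_mem (ha i hi)

/-- The index set of the diagram: the empty set, the vertices and the edges of `Γ`. -/
def SmallClique {I : Type*} (Γ : SimpleGraph I) : Type _ :=
  {T : Set I // T = ∅ ∨ (∃ i, T = {i}) ∨ ∃ i j, Γ.Adj i j ∧ T = {i, j}}

/-- The relations which identify each group of the diagram with its image in the larger ones. -/
def inclusionRelations {I : Type*} (Γ : SimpleGraph I) {X : I → Type*} (G : I → Type*)
    [∀ i, Group (G i)] [∀ i, MulAction (G i) (X i)] (C : ∀ i, X i) :
    Set (Monoid.CoprodI fun T : SmallClique Γ => partialStabilizer G C T.1) :=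
  {x | ∃ (T T' : SmallClique Γ) (g : partialStabilizer G C T.1)
      (g' : partialStabilizer G C T'.1), T.1 ⊆ T'.1 ∧ (g : ∀ i, G i) = (g' : ∀ i, G i) ∧
      x = Monoid.CoprodI.of (M := fun T : SmallClique Γ => partialStabilizer G C T.1) g *
        (Monoid.CoprodI.of (M := fun T : SmallClique Γ => partialStabilizer G C T.1) g')⁻¹}

/-- The generalized graph product of the groups `G i` acting on the sets `X i`, with respect to
`C ∈ ∏ i, X i`: the direct limit (colimit in the category of groups) of `B = ∏ i, Stab (C i)`,
of the groups `H_i` and, for the edges `{i, j}`, of the groups `H_{i,j}`, along the inclusions. It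
is the quotient of the free product of these groups by the relations given by the inclusions. -/
def GeneralizedGraphProduct {I : Type*} (Γ : SimpleGraph I) {X : I → Type*} (G : I → Type*)
    [∀ i, Group (G i)] [∀ i, MulAction (G i) (X i)] (C : ∀ i, X i) : Type _ :=
  (Monoid.CoprodI fun T : SmallClique Γ => partialStabilizer G C T.1) ⧸
    Subgroup.normalClosure (inclusionRelations Γ G C)

instance {I : Type*} (Γ : SimpleGraph I) {X : I → Type*} (G : I → Type*)
    [∀ i, Group (G i)] [∀ i, MulAction (G i) (X i)] (C : ∀ i, X i) :
    Group (GeneralizedGraphProduct Γ G C) :=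
  inferInstanceAs (Group ((Monoid.CoprodI fun T : SmallClique Γ => partialStabilizer G C T.1) ⧸
    Subgroup.normalClosure (inclusionRelations Γ G C)))

/-! ### Residual finiteness of finite index overgroups -/

/-! Both groups are virtually subgroups of graph products of finite groups, and such a graph product
is residually finite when the graph is finite.

Residual finiteness of the graph product comes from normal forms. A word is stored as a stack of
pairwise commuting syllables, every syllable lying as low as possible. Limiting the stack to `n`
levels gives an action on a finite set, and for `n` large compared with a word the stack built from
the empty one multiplies back to the element (`exists_stackProd_stackAction`). Hence a nontrivial
element acts nontrivially for some `n`.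

For the standard lattice, put an arbitrary abelian group structure on every finite set of chambers.
The graph product of these groups acts on the universal cover by changing one coordinate at a time,
and this action is simply transitive: an edge path has a label in the graph product, the label is
invariant under homotopy because every simplex lies in one spherical residue (`label_elementary`),
and the label leads from the base chamber back to the end of the path (`act_classLabel`). Deck
transformations commute with the action (`map_act`), so they embed in the graph product. They have
finite index because the product of the `G i` is finite.

For the direct limit, the kernel of the projection to the product of the `G i` has finite index.
Labels are now taken in the graph product of the orbits of the `C i`; `translateHom` yields a
homomorphism from the kernel to it. The graph product also acts on the cosets of the image of `H_∅`
(`cosetAct`), and `cosetAct_translateHom` compares the two: an element with trivial label lies in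
that image, on which the projection is injective. -/

theorem Group.ResiduallyFinite.of_finiteIndex_of_injective {G F : Type*} [Group G] [Group F]
    [Group.ResiduallyFinite F] (N : Subgroup G) [N.FiniteIndex] (f : N →* F)
    (hf : Function.Injective f) : Group.ResiduallyFinite G := by
  rw [Group.residuallyFinite_iff_exists_finiteIndex]
  intro g hg
  by_cases hgN : g ∈ N
  · have hfg : f ⟨g, hgN⟩ ≠ 1 := fun h => hg <| congrArg Subtype.val <|
      hf (h.trans (map_one f).symm)
    obtain ⟨K, hgK⟩ := Group.exists_finiteIndexNormalSubgroup_notMem _ hfg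
    refine ⟨(K.comap f).toSubgroup.map N.subtype, ⟨?_⟩, ?_⟩
    · rw [Subgroup.index_map_subtype]
      exact mul_ne_zero Subgroup.FiniteIndex.index_ne_zero Subgroup.FiniteIndex.index_ne_zero
    · rintro ⟨x, hx, rfl⟩
      exact hgK hx
  · exact ⟨N, inferInstance, hgN⟩

/-! ### Graph products of groups -/

/-- The relations of the graph product of groups: factors at adjacent vertices commute. -/
def commutingRelations {I : Type*} (Γ : SimpleGraph I) (X : I → Type*) [∀ i, Group (X i)] :
    Set (Monoid.CoprodI X) :=
  {x | ∃ (i j : I) (a : X i) (b : X j), Γ.Adj i j ∧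
    x = (Monoid.CoprodI.of a * Monoid.CoprodI.of b) *
      (Monoid.CoprodI.of b * Monoid.CoprodI.of a)⁻¹}

/-- The graph product of a family of groups over a graph. -/
def GroupGraphProduct {I : Type*} (Γ : SimpleGraph I) (X : I → Type*) [∀ i, Group (X i)] :
    Type _ :=
  Monoid.CoprodI X ⧸ Subgroup.normalClosure (commutingRelations Γ X)

instance {I : Type*} (Γ : SimpleGraph I) (X : I → Type*) [∀ i, Group (X i)] :
    Group (GroupGraphProduct Γ X) :=
  inferInstanceAs (Group (Monoid.CoprodI X ⧸ Subgroup.normalClosure (commutingRelations Γ X)))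

namespace GroupGraphProduct

section Basic

variable {I : Type*} {Γ : SimpleGraph I} {X : I → Type*} [∀ i, Group (X i)]

variable (Γ X) in
/-- The projection of the free product onto the graph product. -/
def mk : Monoid.CoprodI X →* GroupGraphProduct Γ X :=
  QuotientGroup.mk' (Subgroup.normalClosure (commutingRelations Γ X))

theorem mk_surjective : Function.Surjective (mk Γ X) :=
  QuotientGroup.mk_surjective

variable (Γ) in
/-- The inclusion of a factor. -/
def of (i : I) : X i →* GroupGraphProduct Γ X :=
  (mk Γ X).comp Monoid.CoprodI.of

theorem commute_of {i j : I} (h : Γ.Adj i j) (a : X i) (b : X j) :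
    Commute (of Γ i a) (of Γ j b) := by
  rw [Commute, SemiconjBy, ← mul_inv_eq_one, of, of, MonoidHom.comp_apply, MonoidHom.comp_apply,
    ← map_mul, ← map_mul, ← map_inv, ← map_mul]
  exact (QuotientGroup.eq_one_iff _).2 (Subgroup.subset_normalClosure ⟨i, j, a, b, h, rfl⟩)

/-- The universal property of the graph product. -/
def lift {H : Type*} [Group H] (f : ∀ i, X i →* H)
    (hf : ∀ i j, Γ.Adj i j → ∀ a b, Commute (f i a) (f j b)) : GroupGraphProduct Γ X →* H :=
  QuotientGroup.lift _ (Monoid.CoprodI.lift f) <| by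
    refine Subgroup.normalClosure_le_normal (N := (Monoid.CoprodI.lift f).ker) ?_
    rintro _ ⟨i, j, a, b, h, rfl⟩
    rw [SetLike.mem_coe, MonoidHom.mem_ker, map_mul, map_inv, mul_inv_eq_one, map_mul, map_mul,
      Monoid.CoprodI.lift_of, Monoid.CoprodI.lift_of]
    exact hf i j h a b

@[simp]
theorem lift_of {H : Type*} [Group H] (f : ∀ i, X i →* H)
    (hf : ∀ i j, Γ.Adj i j → ∀ a b, Commute (f i a) (f j b)) (i : I) (a : X i) :
    lift f hf (of Γ i a) = f i a :=
  Monoid.CoprodI.lift_of f a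

@[elab_as_elim]
theorem induction_left {motive : GroupGraphProduct Γ X → Prop} (w : GroupGraphProduct Γ X)
    (one : motive 1) (of_mul : ∀ i (a : X i) w, motive w → motive (of Γ i a * w)) : motive w := by
  obtain ⟨x, rfl⟩ := mk_surjective w
  induction x using Monoid.CoprodI.induction_left with
  | one => exact one
  | mul a x ih =>
    rw [map_mul]
    exact of_mul _ a _ ih

end Basic

/-! ### Residual finiteness of graph products of finite groups

The graph product acts on finite sets of stacks with `n` levels: a factor `X i` acts on the lowest
level above all entries which do not commute with it. -/

section Stack

variable {I : Type*} (Γ : SimpleGraph I) {X : I → Type*} [∀ i, Group (X i)] {n : ℕ}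

/-- The nontrivial entries of `x` other than the one at `i` are adjacent to `i`. -/
def IsFree (i : I) (x : ∀ i, X i) : Prop :=
  ∀ j, j ≠ i → ¬ Γ.Adj i j → x j = 1

/-- `k` is the lowest level above all the entries of `z` which do not commute with `X i`. -/
def IsActive (i : I) (z : Fin n → ∀ i, X i) (k : Fin n) : Prop :=
  (∀ k', k ≤ k' → IsFree Γ i (z k')) ∧ ∀ k' : Fin n, (k' : ℕ) + 1 = k → ¬ IsFree Γ i (z k')

open Classical in
/-- Multiplication by an element of `X i` at the active level. -/
noncomputable def push (i : I) (a : X i) (z : Fin n → ∀ i, X i) : Fin n → ∀ i, X i :=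
  fun k => if IsActive Γ i z k then Function.update (z k) i (a * z k i) else z k

variable {Γ}

open Classical in
theorem push_apply_of_ne {i j : I} (h : j ≠ i) (a : X i) (z : Fin n → ∀ i, X i) (k : Fin n) :
    push Γ i a z k j = z k j := by
  unfold push
  split_ifs
  · rw [Function.update_of_ne h]
  · rfl

open Classical in
theorem push_apply_self (i : I) (a : X i) (z : Fin n → ∀ i, X i) (k : Fin n) :
    push Γ i a z k i = if IsActive Γ i z k then a * z k i else z k i := by
  unfold push
  split_ifs
  · rw [Function.update_self]
  · rfl

/-- Freeness for `i` ignores the entries at `i` and at its neighbours, and a push at `j` alters only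
entries at `j`. Active levels are therefore unaffected, which makes pushes an action with adjacent
ones commuting. -/
theorem isFree_push {i j : I} (h : i = j ∨ Γ.Adj i j) (a : X j) (z : Fin n → ∀ i, X i)
    (k : Fin n) : IsFree Γ i (push Γ j a z k) ↔ IsFree Γ i (z k) := by
  refine forall_congr' fun l => forall_congr' fun hl => forall_congr' fun hil => ?_
  rw [push_apply_of_ne]
  rintro rfl
  exact h.elim (fun h => hl h.symm) hil

theorem isActive_push {i j : I} (h : i = j ∨ Γ.Adj i j) (a : X j) (z : Fin n → ∀ i, X i)
    (k : Fin n) : IsActive Γ i (push Γ j a z) k ↔ IsActive Γ i z k := by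
  simp only [IsActive, isFree_push h]

theorem push_one (i : I) (z : Fin n → ∀ i, X i) : push Γ i 1 z = z := by
  funext k j
  rcases eq_or_ne j i with rfl | hj
  · rw [push_apply_self]
    simp
  · rw [push_apply_of_ne hj]

theorem push_mul (i : I) (a b : X i) (z : Fin n → ∀ i, X i) :
    push Γ i (a * b) z = push Γ i a (push Γ i b z) := by
  funext k j
  rcases eq_or_ne j i with rfl | hj
  · by_cases h : IsActive Γ j z k
    · simp only [push_apply_self, if_pos h, if_pos ((isActive_push (Or.inl rfl) b z k).2 h),
        mul_assoc]
    · simp only [push_apply_self, if_neg h, if_neg (mt (isActive_push (Or.inl rfl) b z k).1 h)]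
  · simp only [push_apply_of_ne hj]

open Classical in
theorem push_comm {i j : I} (h : Γ.Adj i j) (a : X i) (b : X j) (z : Fin n → ∀ i, X i) :
    push Γ i a (push Γ j b z) = push Γ j b (push Γ i a z) := by
  funext k l
  rcases eq_or_ne l i with rfl | hi
  · rw [push_apply_of_ne h.ne, push_apply_self, push_apply_self, push_apply_of_ne h.ne]
    exact if_congr (isActive_push (Or.inr h) b z k) rfl rfl
  rcases eq_or_ne l j with rfl | hj
  · rw [push_apply_of_ne h.ne', push_apply_self, push_apply_self, push_apply_of_ne h.ne']
    exact (if_congr (isActive_push (Or.inr h.symm) a z k) rfl rfl).symm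
  · simp only [push_apply_of_ne hi, push_apply_of_ne hj]

variable (Γ X n) in
/-- The action of the graph product on stacks with `n` levels. -/
noncomputable def stackAction : GroupGraphProduct Γ X →* Equiv.Perm (Fin n → ∀ i, X i) :=
  lift (fun i =>
    letI : MulAction (X i) (Fin n → ∀ i, X i) :=
      { smul := push Γ i, one_smul := push_one i, mul_smul := push_mul i }
    MulAction.toPermHom (X i) (Fin n → ∀ i, X i))
    fun _ _ h a b => Equiv.ext fun z => push_comm h a b z

theorem stackAction_of_mul (i : I) (a : X i) (w : GroupGraphProduct Γ X)
    (z : Fin n → ∀ i, X i) :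
    stackAction Γ X n (of Γ i a * w) z = push Γ i a (stackAction Γ X n w z) := by
  rw [map_mul, Equiv.Perm.mul_apply]
  exact congrArg (fun e : Equiv.Perm _ => e _) (lift_of _ _ i a)

/-- The nontrivial entries of every level commute, and no entry can be moved down. -/
def IsStacked (Γ : SimpleGraph I) (z : Fin n → ∀ i, X i) : Prop :=
  ∀ k i, z k i ≠ 1 → IsFree Γ i (z k) ∧ ∀ k' : Fin n, (k' : ℕ) + 1 = k → ¬ IsFree Γ i (z k')

theorem IsStacked.push {z : Fin n → ∀ i, X i} (hz : IsStacked Γ z) (i : I) (a : X i) :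
    IsStacked Γ (push Γ i a z) := by
  intro k j hj
  rcases eq_or_ne j i with rfl | hji
  · simp only [isFree_push (Or.inl rfl)]
    rw [push_apply_self] at hj
    split_ifs at hj with h
    · exact ⟨h.1 k le_rfl, h.2⟩
    · exact hz k j hj
  · rw [push_apply_of_ne hji] at hj
    obtain ⟨h1, h2⟩ := hz k j hj
    by_cases hadj : Γ.Adj j i
    · simp only [isFree_push (Or.inr hadj)]
      exact ⟨h1, h2⟩
    -- The entry at level `k` blocks `i`, so the active level is strictly above `k`; levels `k` and
    -- `k - 1` are untouched.
    have key : ∀ k', IsActive Γ i z k' → ¬ k' ≤ k := fun k' hk' hle =>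
      hj (hk'.1 k hle j hji fun h => hadj h.symm)
    refine ⟨fun l hl hjl => ?_, fun k' hk' hfree => h2 k' hk' fun l hl hjl => ?_⟩
    · rcases eq_or_ne l i with rfl | hli
      · rw [push_apply_self, if_neg fun h => key k h le_rfl]
        exact h1 l hl hjl
      · rw [push_apply_of_ne hli]
        exact h1 l hl hjl
    · have := hfree l hl hjl
      rcases eq_or_ne l i with rfl | hli
      · rwa [push_apply_self, if_neg fun h => key k' h (by rw [Fin.le_def]; omega)] at this
      · rwa [push_apply_of_ne hli] at this

/-- A trivial level on top guarantees an active one; in a full stack there may be none, and then a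
push does nothing. The bound by `m` shows that one letter raises the height by at most one. -/
theorem exists_isActive (i : I) {z : Fin n → ∀ i, X i} {m : ℕ} (hm : m < n)
    (hz : ∀ k : Fin n, m ≤ k → z k = 1) : ∃ k : Fin n, (k : ℕ) ≤ m ∧ IsActive Γ i z k := by
  classical
  have hex : ∃ p : ℕ, ∀ k : Fin n, p ≤ k → IsFree Γ i (z k) :=
    ⟨m, fun k hk _ _ _ => by rw [hz k hk]; rfl⟩
  have hle : Nat.find hex ≤ m := Nat.find_min' hex fun k hk _ _ _ => by rw [hz k hk]; rfl
  refine ⟨⟨Nat.find hex, hle.trans_lt hm⟩, hle, fun k' hk' => Nat.find_spec hex k' hk', ?_⟩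
  intro k' hk' hfree
  refine Nat.find_min hex (m := k') (by simp only at hk'; omega) fun k hk => ?_
  rcases hk.eq_or_lt with h | h
  · rwa [← Fin.ext h]
  · exact Nat.find_spec hex k (by simp only at hk'; omega)

theorem IsActive.unique {i : I} {z : Fin n → ∀ i, X i} {k k' : Fin n} (hk : IsActive Γ i z k)
    (hk' : IsActive Γ i z k') : k = k' := by
  by_contra hne
  wlog h : k < k' generalizing k k'
  · exact this hk' hk (Ne.symm hne) (lt_of_le_of_ne (not_lt.1 h) (Ne.symm hne))
  rw [Fin.lt_def] at h
  refine hk'.2 ⟨k' - 1, by omega⟩ (by simp only; omega) (hk.1 _ ?_)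
  rw [Fin.le_def]
  simp only
  omega

theorem IsStacked.eq_one_of_lt {i : I} {z : Fin n → ∀ i, X i} (hz : IsStacked Γ z) {k k' : Fin n}
    (hk : IsActive Γ i z k) (h : k < k') : z k' i = 1 := by
  by_contra hne
  rw [Fin.lt_def] at h
  refine (hz k' i hne).2 ⟨k' - 1, by omega⟩ (by simp only; omega) (hk.1 _ ?_)
  rw [Fin.le_def]
  simp only
  omega

/-- Factors over a clique commute elementwise, so each `y i` can be moved past the later `x j`. -/
theorem list_prod_mul {T : Set I} (hT : T.Pairwise Γ.Adj) {x y : ∀ i, X i} {l : List I}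
    (hl : l.Nodup) (hx : ∀ i, i ∉ T → x i = 1) (hy : ∀ i, i ∉ T → y i = 1) :
    (l.map fun i => of Γ i (x i * y i)).prod =
      (l.map fun i => of Γ i (x i)).prod * (l.map fun i => of Γ i (y i)).prod := by
  induction l with
  | nil => simp
  | cons i l ih =>
    rw [List.nodup_cons] at hl
    have hc : Commute (of Γ i (y i)) (l.map fun i => of Γ i (x i)).prod := by
      refine Commute.list_prod_right _ _ fun u hu => ?_
      obtain ⟨j, hj, rfl⟩ := List.mem_map.1 hu
      by_cases hi : i ∈ T
      · by_cases hjT : j ∈ T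
        · exact commute_of (hT hi hjT fun h => hl.1 (h ▸ hj)) _ _
        · simp [hx j hjT]
      · simp [hy i hi]
    rw [List.map_cons, List.map_cons, List.map_cons, List.prod_cons, List.prod_cons,
      List.prod_cons, ih hl.2, map_mul, mul_assoc, mul_assoc, ← mul_assoc (of Γ i (y i)), hc.eq, mul_assoc]

theorem list_prod_of_eq_one {x : ∀ i, X i} {i : I} {l : List I} (hl : l.Nodup) (hi : i ∈ l)
    (hx : ∀ j, j ≠ i → x j = 1) : (l.map fun i => of Γ i (x i)).prod = of Γ i (x i) := by
  induction l with
  | nil => simp at hi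
  | cons j l ih =>
    rw [List.nodup_cons] at hl
    rw [List.map_cons, List.prod_cons]
    rcases List.mem_cons.1 hi with rfl | h
    · rw [List.prod_eq_one, mul_one]
      intro u hu
      obtain ⟨j, hj, rfl⟩ := List.mem_map.1 hu
      rw [hx j fun h => hl.1 (h ▸ hj), map_one]
    · rw [ih hl.2 h, hx j fun h' => hl.1 (h' ▸ h), map_one, one_mul]

variable [Fintype I]

variable (Γ) in
/-- The product of the entries of a family, in a fixed order. -/
noncomputable def orderedProd (x : ∀ i, X i) : GroupGraphProduct Γ X :=
  (Finset.univ.toList.map fun i => of Γ i (x i)).prod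

theorem commute_orderedProd {i : I} (a : X i) {x : ∀ i, X i} (hx : IsFree Γ i x) (hi : x i = 1) :
    Commute (of Γ i a) (orderedProd Γ x) := by
  refine Commute.list_prod_right _ _ fun y hy => ?_
  obtain ⟨j, -, rfl⟩ := List.mem_map.1 hy
  by_cases h : Γ.Adj i j
  · exact commute_of h _ _
  · rcases eq_or_ne j i with rfl | hj
    · simp [hi]
    · simp [hx j hj h]

theorem orderedProd_mul {T : Set I} (hT : T.Pairwise Γ.Adj) {x y : ∀ i, X i}
    (hx : ∀ i, i ∉ T → x i = 1) (hy : ∀ i, i ∉ T → y i = 1) :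
    orderedProd Γ (x * y) = orderedProd Γ x * orderedProd Γ y :=
  list_prod_mul hT (Finset.nodup_toList _) hx hy

theorem orderedProd_one : orderedProd Γ (1 : ∀ i, X i) = 1 := by
  simp [orderedProd]

theorem orderedProd_of_eq_one {x : ∀ i, X i} {i : I} (hx : ∀ j, j ≠ i → x j = 1) :
    orderedProd Γ x = of Γ i (x i) :=
  list_prod_of_eq_one (Finset.nodup_toList _) (by simp) hx

theorem orderedProd_update [DecidableEq I] {i : I} (a : X i) {x : ∀ i, X i}
    (hx : ∀ j, x j ≠ 1 → IsFree Γ j x) (hi : IsFree Γ i x) :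
    orderedProd Γ (Function.update x i (a * x i)) = of Γ i a * orderedProd Γ x := by
  have h1 : Function.update x i (a * x i) = Pi.mulSingle i a * x := by
    funext j
    rcases eq_or_ne j i with rfl | hj
    · simp
    · simp [hj]
  have h2 : of Γ i a = orderedProd Γ (Pi.mulSingle i a) := by
    rw [orderedProd_of_eq_one (i := i) fun j hj => Pi.mulSingle_eq_of_ne hj a,
      Pi.mulSingle_eq_same]
  rw [h1, h2]
  -- The support of `x` is a clique by `hx`, and `hi` joins `i` to the rest of it.
  refine orderedProd_mul (T := insert i {j | x j ≠ 1}) ?_ ?_ ?_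
  · have key : ∀ j, x j ≠ 1 → j ≠ i → Γ.Adj i j := fun j hj hji =>
      by_contra fun h => hj (hi j hji h)
    rintro j (rfl | hj) l (rfl | hl) hne
    · exact absurd rfl hne
    · exact key l hl hne.symm
    · exact (key j hj hne).symm
    · exact by_contra fun h => hl (hx j hj l hne.symm h)
  · intro j hj
    exact Pi.mulSingle_eq_of_ne (fun h => hj (Or.inl h)) a
  · intro j hj
    exact by_contra fun h => hj (Or.inr h)

variable (Γ) in
/-- The product of the lowest `m` levels of a stack. -/
noncomputable def stackProd (z : Fin n → ∀ i, X i) : ℕ → GroupGraphProduct Γ X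
  | 0 => 1
  | m + 1 => (if h : m < n then orderedProd Γ (z ⟨m, h⟩) else 1) * stackProd z m

/-- Higher levels stand further left. The new letter enters at level `k`, and it passes to the far
left since the levels above `k` are free for `i` with trivial `i`-th entry. -/
theorem stackProd_push {i : I} (a : X i) {z : Fin n → ∀ i, X i} (hz : IsStacked Γ z) {k : Fin n}
    (hk : IsActive Γ i z k) (m : ℕ) :
    stackProd Γ (push Γ i a z) m =
      if m ≤ k then stackProd Γ z m else of Γ i a * stackProd Γ z m := by
  classical
  induction m with
  | zero => simp [stackProd]
  | succ m ih =>
    rw [stackProd, stackProd, ih]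
    rcases lt_trichotomy m (k : ℕ) with h | h | h
    · have hmn : m < n := h.trans k.2
      have hna : ¬ IsActive Γ i z ⟨m, hmn⟩ := fun h' => by
        have := congrArg Fin.val (hk.unique h')
        simp only at this
        omega
      rw [if_pos h.le, if_pos (show m + 1 ≤ (k : ℕ) by omega), dif_pos hmn, dif_pos hmn]
      simp only [push, if_neg hna]
    · have hmn : m < n := h ▸ k.2
      have hmk : (⟨m, hmn⟩ : Fin n) = k := Fin.ext h
      rw [if_pos h.le, if_neg (show ¬ m + 1 ≤ (k : ℕ) by omega), dif_pos hmn, dif_pos hmn, hmk]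
      simp only [push, if_pos hk]
      rw [orderedProd_update a (fun j hj => (hz k j hj).1) (hk.1 k le_rfl), mul_assoc]
    · rw [if_neg (show ¬ m ≤ (k : ℕ) by omega), if_neg (show ¬ m + 1 ≤ (k : ℕ) by omega)]
      by_cases hmn : m < n
      · have hlt : k < ⟨m, hmn⟩ := h
        have hna : ¬ IsActive Γ i z ⟨m, hmn⟩ := fun h' => hlt.ne (hk.unique h')
        rw [dif_pos hmn, dif_pos hmn]
        simp only [push, if_neg hna]
        rw [← mul_assoc, ← mul_assoc,
          (commute_orderedProd a (hk.1 _ hlt.le) (hz.eq_one_of_lt hk hlt)).eq]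
      · rw [dif_neg hmn, dif_neg hmn, one_mul, one_mul]

theorem stackProd_one (m : ℕ) : stackProd Γ (fun _ => 1 : Fin n → ∀ i, X i) m = 1 := by
  induction m with
  | zero => rfl
  | succ m ih =>
    rw [stackProd, ih, mul_one]
    split_ifs
    · exact orderedProd_one
    · rfl

theorem exists_stackProd_stackAction (w : GroupGraphProduct Γ X) :
    ∃ N : ℕ, ∀ n, N ≤ n → IsStacked Γ (stackAction Γ X n w fun _ => 1) ∧
      (∀ k : Fin n, N ≤ k → stackAction Γ X n w (fun _ => 1) k = 1) ∧
      stackProd Γ (stackAction Γ X n w fun _ => 1) n = w := by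
  induction w using induction_left with
  | one =>
    refine ⟨0, fun n _ => ?_⟩
    rw [map_one, Equiv.Perm.one_apply]
    exact ⟨fun k i h => absurd rfl h, fun k _ => rfl, stackProd_one n⟩
  | of_mul i a w ih =>
    obtain ⟨N, hN⟩ := ih
    -- One more letter may open one new level.
    refine ⟨N + 1, fun n hn => ?_⟩
    obtain ⟨h1, h2, h3⟩ := hN n (by omega)
    obtain ⟨k, hkN, hk⟩ := exists_isActive (Γ := Γ) i (show N < n by omega) h2
    rw [stackAction_of_mul]
    refine ⟨h1.push i a, fun k' hk' => ?_, ?_⟩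
    · have hna : ¬ IsActive Γ i (stackAction Γ X n w fun _ => 1) k' := fun h' => by
        have := congrArg Fin.val (hk.unique h')
        omega
      simp only [push, if_neg hna]
      exact h2 k' (by omega)
    · rw [stackProd_push a h1 hk, if_neg (by omega), h3]

end Stack

instance residuallyFinite {I : Type*} [Finite I] (Γ : SimpleGraph I) (X : I → Type*)
    [∀ i, Group (X i)] [∀ i, Finite (X i)] : Group.ResiduallyFinite (GroupGraphProduct Γ X) := by
  rw [Group.residuallyFinite_iff_exists_finiteIndex]
  intro w hw
  cases nonempty_fintype I
  obtain ⟨n, hn⟩ := exists_stackProd_stackAction w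
  refine ⟨(stackAction Γ X n).ker, Subgroup.finiteIndex_ker _, fun h => hw ?_⟩
  have := (hn n le_rfl).2.2
  rwa [MonoidHom.mem_ker.1 h, Equiv.Perm.one_apply, stackProd_one, eq_comm] at this

end GroupGraphProduct

/-! ### Spherical sets of generators of right angled Coxeter groups -/

/-- If `i` and `j` are distinct and not adjacent, send them to two reflections of the infinite
dihedral group `DihedralGroup 0` and all other generators to `1`. The product of the two generators
then has infinite order. -/
theorem IsSpherical.pairwise_adj {I : Type*} {Γ : SimpleGraph I} {T : Set I}
    (hT : IsSpherical Γ T) : T.Pairwise Γ.Adj := by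
  classical
  intro i hi j hj hij
  by_contra hadj
  let f : I → DihedralGroup 0 := fun k =>
    if k = i then .sr 0 else if k = j then .sr 1 else 1
  have hsq : ∀ k, f k * f k = 1 := by
    intro k
    simp only [f]
    split_ifs <;> simp
  have hone : ∀ k, k ≠ i → k ≠ j → f k = 1 := fun k h1 h2 => by simp [f, h1, h2]
  have hf : (rightAngledMatrix Γ).IsLiftable f := by
    intro k l
    rcases eq_or_ne k l with rfl | hkl
    · rw [hsq, one_pow]
    by_cases h : Γ.Adj k l
    · have hM : rightAngledMatrix Γ k l = 2 := by
        change (if k = l then 1 else if Γ.Adj k l then 2 else 0) = 2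
        rw [if_neg hkl, if_pos h]
      have hk1 : f k = 1 ∨ f l = 1 := by
        by_cases hki : k = i
        · refine Or.inr (hone l (fun h' => hkl (hki.trans h'.symm)) fun h' => hadj ?_)
          rw [← hki, ← h']
          exact h
        by_cases hkj : k = j
        · refine Or.inr (hone l (fun h' => hadj ?_) fun h' => hkl (hkj.trans h'.symm))
          rw [← hkj, ← h']
          exact h.symm
        · exact Or.inl (hone k hki hkj)
      rw [hM, pow_two]
      rcases hk1 with h' | h' <;> simp [h', hsq]
    · have hM : rightAngledMatrix Γ k l = 0 := by
        change (if k = l then 1 else if Γ.Adj k l then 2 else 0) = 0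
        rw [if_neg hkl, if_neg h]
      rw [hM, pow_zero]
  let cs := (rightAngledMatrix Γ).toCoxeterSystem
  have hcs : ∀ k, cs.lift ⟨f, hf⟩ ((rightAngledMatrix Γ).simple k) = f k := fun k => by
    rw [← CoxeterMatrix.toCoxeterSystem_simple]
    exact cs.lift_apply_simple hf k
  have hmem : ∀ k ∈ T, (rightAngledMatrix Γ).simple k ∈
      Subgroup.closure ((rightAngledMatrix Γ).simple '' T) := fun k hk =>
    Subgroup.subset_closure (Set.mem_image_of_mem _ hk)
  have : Finite (Subgroup.closure ((rightAngledMatrix Γ).simple '' T)) := hT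
  have hfin := isOfFinOrder_of_finite
    (⟨_, mul_mem (hmem i hi) (hmem j hj)⟩ : Subgroup.closure ((rightAngledMatrix Γ).simple '' T))
  have hfin' := ((cs.lift ⟨f, hf⟩).comp (Subgroup.subtype _)).isOfFinOrder hfin
  have hr : ((cs.lift ⟨f, hf⟩).comp (Subgroup.subtype _))
      (⟨_, mul_mem (hmem i hi) (hmem j hj)⟩ :
        Subgroup.closure ((rightAngledMatrix Γ).simple '' T)) = DihedralGroup.r 1 := by
    change cs.lift ⟨f, hf⟩ (_ * _) = _
    rw [map_mul, hcs, hcs]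
    simp [f, hij.symm]
  rw [hr, ← orderOf_pos_iff, DihedralGroup.orderOf_r_one] at hfin'
  exact absurd hfin' (lt_irrefl 0)

theorem finite_closure_pair {W : Type*} [Group W] {s t : W} (hs : s * s = 1) (ht : t * t = 1)
    (hst : Commute s t) : Finite (Subgroup.closure {s, t}) := by
  have hfin : ∀ u : W, u * u = 1 → Finite (Subgroup.zpowers u) := fun u hu => by
    exact finite_zpowers.2 <| isOfFinOrder_iff_pow_eq_one.2 ⟨2, two_pos, by rw [pow_two, hu]⟩
  have := hfin s hs
  have := hfin t ht
  let f := MonoidHom.noncommCoprod (Subgroup.zpowers s).subtype (Subgroup.zpowers t).subtype <| by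
    rintro ⟨_, m, rfl⟩ ⟨_, n, rfl⟩
    exact hst.zpow_zpow m n
  have hle : Subgroup.closure {s, t} ≤ f.range := by
    rw [Subgroup.closure_le]
    rintro _ (rfl | rfl)
    · exact ⟨(⟨_, Subgroup.mem_zpowers _⟩, 1), by simp [f]⟩
    · exact ⟨(1, ⟨_, Subgroup.mem_zpowers _⟩), by simp [f]⟩
  have : Finite f.range := Set.finite_range f
  exact Finite.of_injective _ (Subgroup.inclusion_injective hle)

theorem isSpherical_pair {I : Type*} {Γ : SimpleGraph I} {i j : I} (h : i = j ∨ Γ.Adj i j) :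
    IsSpherical Γ {i, j} := by
  classical
  let cs := (rightAngledMatrix Γ).toCoxeterSystem
  have hsq : ∀ k, (rightAngledMatrix Γ).simple k * (rightAngledMatrix Γ).simple k = 1 := fun k => by
    rw [← CoxeterMatrix.toCoxeterSystem_simple]
    exact cs.simple_mul_simple_self k
  rw [IsSpherical, Set.image_pair]
  refine finite_closure_pair (hsq i) (hsq j) ?_
  rcases h with rfl | h
  · exact Commute.refl _
  · have hM : rightAngledMatrix Γ i j = 2 := by
      change (if i = j then 1 else if Γ.Adj i j then 2 else 0) = 2
      rw [if_neg h.ne, if_pos h]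
    have := cs.simple_mul_simple_pow i j
    rw [hM, pow_two, mul_eq_one_iff_eq_inv, mul_inv_rev, cs.inv_simple, cs.inv_simple] at this
    rw [← CoxeterMatrix.toCoxeterSystem_simple]
    exact this

theorem isSpherical_singleton {I : Type*} (Γ : SimpleGraph I) (i : I) : IsSpherical Γ {i} := by
  have := isSpherical_pair (Γ := Γ) (Or.inl (rfl : i = i))
  rwa [Set.pair_eq_singleton] at this

/-! ### Homotopy classes of edge paths -/

theorem PathClass.snoc_snoc {P : Type*} [PartialOrder P] {a b c d : P} (x : PathClass a b)
    (hbc : b ≤ c ∨ c ≤ b) (hcd : c ≤ d ∨ d ≤ c) (hbd : b ≤ d ∨ d ≤ b) :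
    (x.snoc hbc).snoc hcd = x.snoc hbd := by
  obtain ⟨p, rfl⟩ := Quot.exists_rep x
  exact Quot.sound (.triangle p hbc hcd hbd)

theorem PathClass.snoc_self {P : Type*} [PartialOrder P] {a b : P} (x : PathClass a b)
    (h : b ≤ b ∨ b ≤ b) : x.snoc h = x := by
  obtain ⟨p, rfl⟩ := Quot.exists_rep x
  exact Quot.sound (.stutter p h)

/-! ### Residues of the product -/

section Residue

variable {I : Type*} {Γ : SimpleGraph I} {X : I → Type*}

theorem mem_productResidue_self (T : Set I) (C : ∀ i, X i) : C ∈ productResidue T C :=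
  fun _ _ => rfl

theorem chamberVertex_le {C : ∀ i, X i} {R : SphericalResidue Γ X} :
    chamberVertex Γ C ≤ R ↔ C ∈ R.carrier := by
  refine ⟨fun h => h.2 (mem_productResidue_self ∅ C), fun h => ⟨Set.empty_subset _, ?_⟩⟩
  intro D hD
  rwa [show D = C from funext fun i => hD i (Set.notMem_empty i)]

theorem SphericalResidue.apply_eq {R : SphericalResidue Γ X} {C D : ∀ i, X i}
    (hC : C ∈ R.carrier) (hD : D ∈ R.carrier) {i : I} (hi : i ∉ R.type) : C i = D i := by
  obtain ⟨E, hE⟩ := R.isResidue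
  rw [hE] at hC hD
  rw [hC i hi, hD i hi]

theorem SphericalResidue.mem_of_apply_eq {R : SphericalResidue Γ X} {C D : ∀ i, X i}
    (hC : C ∈ R.carrier) (hD : ∀ i, i ∉ R.type → D i = C i) : D ∈ R.carrier := by
  obtain ⟨E, hE⟩ := R.isResidue
  rw [hE] at hC ⊢
  exact fun i hi => (hD i hi).trans (hC i hi)

/-- The residue of spherical type `T` of the chamber `C`. -/
def residueVertex {T : Set I} (hT : IsSpherical Γ T) (C : ∀ i, X i) : SphericalResidue Γ X where
  type := T
  carrier := productResidue T C
  spherical := hT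
  isResidue := ⟨C, rfl⟩

/-- A chamber in a residue. -/
noncomputable def SphericalResidue.center (R : SphericalResidue Γ X) : ∀ i, X i :=
  R.isResidue.choose

theorem SphericalResidue.center_mem (R : SphericalResidue Γ X) : R.center ∈ R.carrier := by
  rw [R.isResidue.choose_spec]
  exact mem_productResidue_self _ _

theorem center_chamberVertex (C : ∀ i, X i) : (chamberVertex Γ C).center = C :=
  funext fun i => (chamberVertex Γ C).center_mem i (Set.notMem_empty i)

end Residue

/-! ### Passing between chambers through a common residue -/

namespace GraphProduct

section Via

variable {I : Type*} {Γ : SimpleGraph I} {X : I → Type*} {C₀ : ∀ i, X i}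

/-- The chamber over `D` reached from the chamber `x` through the residue `R`. -/
def via (x : GraphProduct Γ C₀) (R : SphericalResidue Γ X) (D : ∀ i, X i)
    (hx : chamberVertex Γ x.1 ≤ R) (hD : chamberVertex Γ D ≤ R) : GraphProduct Γ C₀ :=
  ⟨D, (x.2.snoc (Or.inl hx)).snoc (Or.inr hD)⟩

theorem eq_of_snoc_eq {x y : GraphProduct Γ C₀}
    (h : chamberVertex Γ x.1 ≤ chamberVertex Γ y.1) (hxy : x.2.snoc (Or.inl h) = y.2) : x = y := by
  obtain ⟨C, p⟩ := x
  obtain ⟨D, q⟩ := y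
  obtain rfl : C = D := funext fun i => chamberVertex_le.1 h i (Set.notMem_empty i)
  simp only at hxy
  rw [← hxy, PathClass.snoc_self]

theorem via_congr (x : GraphProduct Γ C₀) (R : SphericalResidue Γ X) {D D' : ∀ i, X i}
    (h : D = D') (hx : chamberVertex Γ x.1 ≤ R) (hD : chamberVertex Γ D ≤ R)
    (hD' : chamberVertex Γ D' ≤ R) : x.via R D hx hD = x.via R D' hx hD' := by
  subst h
  rfl

theorem via_self (x : GraphProduct Γ C₀) (R : SphericalResidue Γ X)
    (hx hx' : chamberVertex Γ x.1 ≤ R) : x.via R x.1 hx hx' = x := by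
  obtain ⟨C, p⟩ := x
  simp only [via]
  rw [PathClass.snoc_snoc _ _ _ (Or.inl le_rfl), PathClass.snoc_self]

/-- Two triangles contract the path: the chain `D ≤ R ≤ R'` removes `D`, then `x ≤ R ≤ R'` removes
`R`. -/
theorem via_snoc (x : GraphProduct Γ C₀) {R R' : SphericalResidue Γ X} (hR : R ≤ R')
    {D : ∀ i, X i} (hx : chamberVertex Γ x.1 ≤ R) (hD : chamberVertex Γ D ≤ R)
    (hD' : chamberVertex Γ D ≤ R') :
    (x.via R D hx hD).2.snoc (Or.inl hD') = x.2.snoc (Or.inl (hx.trans hR)) := by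
  exact (PathClass.snoc_snoc _ _ _ (Or.inl hR)).trans (PathClass.snoc_snoc _ _ _ _)

theorem via_via (x : GraphProduct Γ C₀) {R R' : SphericalResidue Γ X} (hR : R ≤ R')
    {D D' : ∀ i, X i} (hx : chamberVertex Γ x.1 ≤ R) (hD : chamberVertex Γ D ≤ R)
    (hDR : chamberVertex Γ D ≤ R') (hD' : chamberVertex Γ D' ≤ R') :
    (x.via R D hx hD).via R' D' hDR hD' = x.via R' D' (hx.trans hR) hD' :=
  congrArg (fun q : PathClass _ R' => (⟨D', q.snoc (Or.inr hD')⟩ : GraphProduct Γ C₀))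
    (x.via_snoc hR hx hD hDR)

theorem via_eq_of_le (x : GraphProduct Γ C₀) {R R' : SphericalResidue Γ X} (hR : R ≤ R')
    {D : ∀ i, X i} (hx : chamberVertex Γ x.1 ≤ R) (hD : chamberVertex Γ D ≤ R) :
    x.via R D hx hD = x.via R' D (hx.trans hR) (hD.trans hR) := by
  rw [← via_via x hR hx hD (hD.trans hR) (hD.trans hR)]
  exact (via_self (x.via R D hx hD) R' (hD.trans hR) (hD.trans hR)).symm

theorem equivalent_via (x : GraphProduct Γ C₀) {R : SphericalResidue Γ X} {D : ∀ i, X i} {i : I}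
    (hi : R.type = {i}) (hx : chamberVertex Γ x.1 ≤ R) (hD : chamberVertex Γ D ≤ R) :
    Equivalent i x (x.via R D hx hD) :=
  ⟨⟨R, x.2.snoc (Or.inl hx)⟩, hi, ⟨hx, rfl⟩, hD, (x.via_snoc le_rfl hx hD hD).symm⟩

theorem Equivalent.exists_eq_via {i : I} {x y : GraphProduct Γ C₀} (h : Equivalent i x y) :
    ∃ (R : SphericalResidue Γ X) (hx : chamberVertex Γ x.1 ≤ R) (hy : chamberVertex Γ y.1 ≤ R),
      R.type = {i} ∧ y = x.via R y.1 hx hy := by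
  obtain ⟨⟨R, r⟩, hi, ⟨hx, hx'⟩, hy, hy'⟩ := h
  refine ⟨R, hx, hy, hi, (via_self y R hy hy).symm.trans ?_⟩
  exact congrArg (fun q : PathClass _ R => (⟨y.1, q.snoc (Or.inr hy)⟩ : GraphProduct Γ C₀))
    (hy'.symm.trans hx')

end Via

end GraphProduct

/-- A cyclic structure will do. It only supplies coordinates on the chambers; automorphisms need not
respect it. -/
theorem nonempty_commGroup_of_finite (X : Type*) [Finite X] [Nonempty X] :
    Nonempty (CommGroup X) := by
  have : NeZero (Nat.card X) := ⟨Nat.card_pos.ne'⟩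
  exact ⟨((Finite.equivFin X).trans Multiplicative.ofAdd).commGroup⟩

namespace GraphProduct

open GroupGraphProduct

/-! ### The action of a graph product of groups on the graph product of their underlying sets -/

section Action

variable {I : Type*} [DecidableEq I] {Γ : SimpleGraph I} {X : I → Type*} [∀ i, CommGroup (X i)]
  {C₀ : ∀ i, X i}

theorem mulSingle_mul_mem {R : SphericalResidue Γ X} {C : ∀ i, X i} (hC : C ∈ R.carrier) {i : I}
    (hi : i ∈ R.type) (a : X i) : Pi.mulSingle i a * C ∈ R.carrier := by
  refine R.mem_of_apply_eq hC fun j hj => ?_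
  have : j ≠ i := fun h => hj (h ▸ hi)
  simp [this]

/-- Multiply the `i`-th coordinate by `a`, moving through the residue of type `{i}`. -/
def move (i : I) (a : X i) (x : GraphProduct Γ C₀) : GraphProduct Γ C₀ :=
  x.via (residueVertex (isSpherical_singleton Γ i) x.1) (Pi.mulSingle i a * x.1)
    (chamberVertex_le.2 (mem_productResidue_self _ _))
    (chamberVertex_le.2 (mulSingle_mul_mem
      (R := residueVertex (isSpherical_singleton Γ i) x.1) (mem_productResidue_self _ _) rfl a))

theorem move_eq_via {i : I} (a : X i) (x : GraphProduct Γ C₀) {R : SphericalResidue Γ X}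
    (hi : i ∈ R.type) (hx : chamberVertex Γ x.1 ≤ R)
    (hD : chamberVertex Γ (Pi.mulSingle i a * x.1) ≤ R) :
    move i a x = x.via R (Pi.mulSingle i a * x.1) hx hD := by
  refine via_eq_of_le x ⟨Set.singleton_subset_iff.2 hi, fun D hD => ?_⟩ _ _
  exact R.mem_of_apply_eq (chamberVertex_le.1 hx) fun j hj => hD j fun h => hj (h ▸ hi)

theorem move_via {i : I} (a : X i) (x : GraphProduct Γ C₀) {R : SphericalResidue Γ X}
    (hi : i ∈ R.type) {D : ∀ i, X i} (hx : chamberVertex Γ x.1 ≤ R) (hD : chamberVertex Γ D ≤ R) :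
    move i a (x.via R D hx hD) = x.via R (Pi.mulSingle i a * D) hx
      (chamberVertex_le.2 (mulSingle_mul_mem (chamberVertex_le.1 hD) hi a)) :=
  (move_eq_via a (x.via R D hx hD) hi hD
    (chamberVertex_le.2 (mulSingle_mul_mem (chamberVertex_le.1 hD) hi a))).trans
    (via_via x le_rfl hx hD hD _)

theorem move_one (i : I) (x : GraphProduct Γ C₀) : move i 1 x = x := by
  have hx := (chamberVertex_le (R := residueVertex (isSpherical_singleton Γ i) x.1)).2
    (mem_productResidue_self {i} x.1)
  exact (via_congr x _ (by simp) hx _ hx).trans (via_self x _ hx hx)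

theorem move_mul (i : I) (a b : X i) (x : GraphProduct Γ C₀) :
    move i (a * b) x = move i a (move i b x) := by
  refine (via_congr x _ ?_ _ _ _).trans (move_via a x (Set.mem_singleton i) _ _).symm
  rw [Pi.mulSingle_mul, mul_assoc]

/-- Adjacency makes the `{i, j}`-residue spherical, hence a vertex of the poset. Both sides pass
through it, so only the final chamber matters. -/
theorem move_comm {i j : I} (h : Γ.Adj i j) (a : X i) (b : X j) (x : GraphProduct Γ C₀) :
    move i a (move j b x) = move j b (move i a x) := by
  let R := residueVertex (X := X) (isSpherical_pair (Or.inr h)) x.1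
  have hi : i ∈ R.type := Or.inl rfl
  have hj : j ∈ R.type := Or.inr rfl
  have hx : x.1 ∈ R.carrier := mem_productResidue_self _ _
  rw [move_eq_via b x hj (chamberVertex_le.2 hx) (chamberVertex_le.2 (mulSingle_mul_mem hx hj b)),
    move_eq_via a x hi (chamberVertex_le.2 hx) (chamberVertex_le.2 (mulSingle_mul_mem hx hi a)),
    move_via a x hi, move_via b x hj]
  refine via_congr x _ ?_ _ _ _
  rw [mul_left_comm]

variable (Γ C₀) in
/-- The action of the graph product of groups. -/
def act : GroupGraphProduct Γ X →* Equiv.Perm (GraphProduct Γ C₀) :=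
  lift (fun i =>
    letI : MulAction (X i) (GraphProduct Γ C₀) :=
      { smul := move i, one_smul := move_one i, mul_smul := move_mul i }
    MulAction.toPermHom (X i) (GraphProduct Γ C₀))
    fun _ _ h a b => Equiv.ext fun x => move_comm h a b x

theorem act_of (i : I) (a : X i) (x : GraphProduct Γ C₀) : act Γ C₀ (of Γ i a) x = move i a x :=
  congrArg (fun e : Equiv.Perm _ => e x) (lift_of _ _ i a)

theorem equivalent_move (i : I) (a : X i) (x : GraphProduct Γ C₀) : Equivalent i x (move i a x) :=
  equivalent_via x rfl _ _

theorem Equivalent.exists_eq_move {i : I} {x y : GraphProduct Γ C₀} (h : Equivalent i x y) :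
    ∃ a, y = move i a x := by
  obtain ⟨R, hx, hy, hR, hxy⟩ := h.exists_eq_via
  have hi : i ∈ R.type := by rw [hR]; rfl
  refine ⟨y.1 i / x.1 i, ?_⟩
  rw [move_eq_via _ x hi hx
    (chamberVertex_le.2 (mulSingle_mul_mem (chamberVertex_le.1 hx) hi _)), hxy]
  refine via_congr x _ (funext fun j => ?_) _ _ _
  rcases eq_or_ne j i with rfl | hj
  · simp [via]
  · simp only [via, Pi.mul_apply, Pi.mulSingle_eq_of_ne hj, one_mul]
    refine R.apply_eq (chamberVertex_le.1 hy) (chamberVertex_le.1 hx) ?_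
    rw [hR]
    exact hj

theorem act_list_prod (x : GraphProduct Γ C₀) {R : SphericalResidue Γ X}
    (hx : chamberVertex Γ x.1 ≤ R) {e : ∀ i, X i} (he : ∀ i, i ∉ R.type → e i = 1) (l : List I) :
    ∃ hD : chamberVertex Γ ((l.map fun i => Pi.mulSingle i (e i)).prod * x.1) ≤ R,
      act Γ C₀ (l.map fun i => of Γ i (e i)).prod x =
        x.via R ((l.map fun i => Pi.mulSingle i (e i)).prod * x.1) hx hD := by
  induction l with
  | nil =>
    have h1 : ((([] : List I).map fun i => Pi.mulSingle i (e i)).prod * x.1) = x.1 := by simp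
    have hD : chamberVertex Γ ((([] : List I).map fun i => Pi.mulSingle i (e i)).prod * x.1) ≤ R :=
      h1.symm ▸ hx
    refine ⟨hD, ?_⟩
    rw [List.map_nil, List.prod_nil, map_one, Equiv.Perm.one_apply]
    exact (via_self x R hx hx).symm.trans (via_congr x R h1.symm hx hx hD)
  | cons i l ih =>
    obtain ⟨hD, ih⟩ := ih
    by_cases hi : i ∈ R.type
    · have hD' := chamberVertex_le.2 (mulSingle_mul_mem (chamberVertex_le.1 hD) hi (e i))
      have h1 : (((i :: l).map fun i => Pi.mulSingle i (e i)).prod * x.1) =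
          Pi.mulSingle i (e i) * ((l.map fun i => Pi.mulSingle i (e i)).prod * x.1) := by
        rw [List.map_cons, List.prod_cons, mul_assoc]
      refine ⟨h1.symm ▸ hD', ?_⟩
      rw [List.map_cons, List.prod_cons, map_mul, Equiv.Perm.mul_apply, ih, act_of,
        move_via (e i) x hi]
      exact via_congr x R h1.symm hx hD' _
    · have h1 : (((i :: l).map fun i => Pi.mulSingle i (e i)).prod * x.1) =
          ((l.map fun i => Pi.mulSingle i (e i)).prod * x.1) := by
        rw [List.map_cons, List.prod_cons, he i hi, Pi.mulSingle_one, one_mul]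
      refine ⟨h1.symm ▸ hD, ?_⟩
      rw [List.map_cons, List.prod_cons, he i hi, map_one, one_mul, ih]
      exact via_congr x R h1.symm hx hD _

/-- Preserving `i`-equivalence, `g` sends a move by `a` to a move by some `b`; equality of
projections forces `b = a`. -/
theorem map_act {g : Equiv.Perm (GraphProduct Γ C₀)}
    (hg : ∀ i x y, Equivalent i x y → Equivalent i (g x) (g y)) (hproj : ∀ x, (g x).proj = x.proj)
    (w : GroupGraphProduct Γ X) (x : GraphProduct Γ C₀) :
    g (act Γ C₀ w x) = act Γ C₀ w (g x) := by
  induction w using GroupGraphProduct.induction_left with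
  | one => rw [map_one, Equiv.Perm.one_apply, Equiv.Perm.one_apply]
  | of_mul i a w ih =>
    rw [map_mul, Equiv.Perm.mul_apply, Equiv.Perm.mul_apply, ← ih, act_of, act_of]
    generalize act Γ C₀ w x = y
    obtain ⟨b, hb⟩ := (hg i _ _ (equivalent_move i a y)).exists_eq_move
    have h1 : Pi.mulSingle i a * y.proj = Pi.mulSingle i b * (g y).proj :=
      (hproj (move i a y)).symm.trans (congrArg proj hb)
    rw [hproj, mul_left_inj] at h1
    rw [hb, Pi.mulSingle_injective i h1]

end Action

/-! ### Labels of edge paths and simple transitivity of the action -/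

section Label

variable {I : Type*} [Fintype I] {Γ : SimpleGraph I} {X : I → Type*}
  [∀ i, CommGroup (X i)] {C₀ : ∀ i, X i}

/-- The element of the graph product of groups described by an edge path. -/
noncomputable def label {a : SphericalResidue Γ X} :
    {b : SphericalResidue Γ X} → EdgePath a b → GroupGraphProduct Γ X
  | _, .nil => 1
  | _, .snoc (b := b) (c := c) p _ => orderedProd Γ (c.center / b.center) * label p

/-- The vertices of a triangle lie below its largest vertex `R`. The quotients of their centers are
supported on the clique `R.type`, where `orderedProd` is multiplicative, so they telescope. -/
theorem label_elementary {a b : SphericalResidue Γ X} {p q : EdgePath a b}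
    (h : EdgePath.Elementary p q) : label p = label q := by
  induction h with
  | stutter p h => rw [label, div_self', orderedProd_one, one_mul]
  | @triangle b c d p hbc hcd hbd =>
    obtain ⟨R, hb, hc, hd⟩ : ∃ R : SphericalResidue Γ X, b ≤ R ∧ c ≤ R ∧ d ≤ R := by
      rcases hbc with h1 | h1 <;> rcases hcd with h2 | h2
      · exact ⟨d, h1.trans h2, h2, le_rfl⟩
      · exact ⟨c, h1, le_rfl, h2⟩
      · rcases hbd with h3 | h3
        · exact ⟨d, h3, h2, le_rfl⟩
        · exact ⟨b, le_rfl, h1, h3⟩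
      · exact ⟨b, le_rfl, h1, h2.trans h1⟩
    have key : ∀ {u v : SphericalResidue Γ X}, u ≤ R → v ≤ R → ∀ i, i ∉ R.type →
        (u.center / v.center) i = 1 := fun {u v} hu hv i hi => by
      rw [Pi.div_apply, div_eq_one]
      exact R.apply_eq (hu.2 u.center_mem) (hv.2 v.center_mem) hi
    rw [label, label, label, ← mul_assoc,
      ← orderedProd_mul R.spherical.pairwise_adj (key hd hc) (key hc hb), div_mul_div_cancel]
  | snoc _ _ ih => rw [label, label, ih]

/-- The element of the graph product of groups described by a homotopy class of edge paths. -/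
noncomputable def classLabel {a b : SphericalResidue Γ X} :
    PathClass a b → GroupGraphProduct Γ X :=
  Quot.lift label fun _ _ => label_elementary

theorem classLabel_snoc {a b c : SphericalResidue Γ X} (x : PathClass a b) (h : b ≤ c ∨ c ≤ b) :
    classLabel (x.snoc h) = orderedProd Γ (c.center / b.center) * classLabel x := by
  obtain ⟨p, rfl⟩ := Quot.exists_rep x
  rfl

variable [DecidableEq I]

theorem act_orderedProd_div (x : GraphProduct Γ C₀) {R : SphericalResidue Γ X} {D : ∀ i, X i}
    (hx : chamberVertex Γ x.1 ≤ R) (hD : chamberVertex Γ D ≤ R) :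
    act Γ C₀ (orderedProd Γ (D / x.1)) x = x.via R D hx hD := by
  obtain ⟨hD', h⟩ := act_list_prod x hx (e := D / x.1) (fun i hi => by
    rw [Pi.div_apply, div_eq_one]
    exact R.apply_eq (chamberVertex_le.1 hD) (chamberVertex_le.1 hx) hi) Finset.univ.toList
  refine h.trans (via_congr x R ?_ _ _ _)
  rw [Finset.prod_map_toList, Finset.univ_prod_mulSingle, div_mul_cancel]

theorem classLabel_move (i : I) (a : X i) (x : GraphProduct Γ C₀) :
    classLabel (move i a x).2 = of Γ i a * classLabel x.2 := by
  let R := residueVertex (X := X) (isSpherical_singleton Γ i) x.1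
  have key : ∀ D ∈ R.carrier, ∀ j, j ∉ R.type → (D / R.center) j = 1 := fun D hD j hj => by
    rw [Pi.div_apply, div_eq_one]
    exact R.apply_eq hD R.center_mem hj
  have key' : ∀ D ∈ R.carrier, ∀ j, j ∉ R.type → (R.center / D) j = 1 := fun D hD j hj => by
    rw [Pi.div_apply, div_eq_one]
    exact R.apply_eq R.center_mem hD hj
  have hx : x.1 ∈ R.carrier := mem_productResidue_self _ _
  have h1 : classLabel (move i a x).2 = orderedProd Γ (Pi.mulSingle i a * x.1 / R.center) *
      (orderedProd Γ (R.center / x.1) * classLabel x.2) := by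
    refine (classLabel_snoc _ _).trans ?_
    rw [classLabel_snoc, center_chamberVertex, center_chamberVertex]
    rfl
  rw [h1, ← mul_assoc, ← orderedProd_mul R.spherical.pairwise_adj
    (key _ (mulSingle_mul_mem hx rfl a)) (key' _ hx), div_mul_div_cancel, mul_div_cancel_right,
    orderedProd_of_eq_one (i := i) fun j hj => Pi.mulSingle_eq_of_ne hj a, Pi.mulSingle_eq_same]

/-- This gives freeness of the action; `act_classLabel` gives transitivity. -/
theorem classLabel_act (w : GroupGraphProduct Γ X) (x : GraphProduct Γ C₀) :
    classLabel (act Γ C₀ w x).2 = w * classLabel x.2 := by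
  induction w using GroupGraphProduct.induction_left with
  | one => rw [map_one, Equiv.Perm.one_apply, one_mul]
  | of_mul i a w ih => rw [map_mul, Equiv.Perm.mul_apply, act_of, classLabel_move, ih, mul_assoc]

variable (Γ C₀) in
/-- The base chamber. -/
def base : GraphProduct Γ C₀ := ⟨C₀, Quot.mk _ .nil⟩

/-- A path ending at `R` is shadowed by a chamber over the center of `R`. Each further edge moves
that chamber through the larger of the edge's two ends. -/
theorem act_label {R : SphericalResidue Γ X} (p : EdgePath (chamberVertex Γ C₀) R) :
    ∃ h : chamberVertex Γ (act Γ C₀ (label p) (base Γ C₀)).1 ≤ R,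
      (act Γ C₀ (label p) (base Γ C₀)).1 = R.center ∧
      (act Γ C₀ (label p) (base Γ C₀)).2.snoc (Or.inl h) = Quot.mk _ p := by
  induction p with
  | nil =>
    rw [label, map_one, Equiv.Perm.one_apply]
    exact ⟨le_rfl, (center_chamberVertex C₀).symm, PathClass.snoc_self _ _⟩
  | @snoc b c p h ih =>
    rw [label, map_mul, Equiv.Perm.mul_apply]
    generalize act Γ C₀ (label p) (base Γ C₀) = y at ih
    obtain ⟨hy, hyb, hyp⟩ := ih
    have hc := chamberVertex_le.2 c.center_mem
    rw [← hyb]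
    rcases h with h | h
    · rw [act_orderedProd_div y (hy.trans h) hc]
      refine ⟨hc, rfl, (via_snoc y le_rfl (hy.trans h) hc hc).trans ?_⟩
      refine (PathClass.snoc_snoc y.2 (Or.inl hy) (Or.inl h) _).symm.trans ?_
      rw [hyp]
      rfl
    · rw [act_orderedProd_div y hy (hc.trans h)]
      refine ⟨hc, rfl, (PathClass.snoc_snoc _ _ _ (Or.inr h)).trans ?_⟩
      rw [hyp]
      rfl

theorem act_classLabel (x : GraphProduct Γ C₀) :
    act Γ C₀ (classLabel x.2) (base Γ C₀) = x := by
  obtain ⟨p, hp⟩ := Quot.exists_rep x.2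
  obtain ⟨h, -, hy⟩ := act_label p
  have hl : classLabel x.2 = label p := by rw [← hp]; rfl
  rw [hl]
  exact eq_of_snoc_eq h (hy.trans hp)

end Label

end GraphProduct

/-! ### Residual finiteness of the standard lattice -/

section LiftGroup

variable {I : Type*} {Γ : SimpleGraph I} {X : I → Type*} {G : I → Type*} [∀ i, Group (G i)]
  [∀ i, MulAction (G i) (X i)] {C₀ : ∀ i, X i}

variable (Γ G C₀) in
/-- The group of deck transformations. -/
def deckGroup : Subgroup (liftGroup Γ G C₀) where
  carrier := {g | ∀ x, (g.1 x).proj = x.proj}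
  one_mem' := fun _ => rfl
  mul_mem' := fun {a b} ha hb x => (ha (b.1 x)).trans (hb x)
  inv_mem' := fun {a} ha x => by
    have := ha ((a⁻¹).1 x)
    rw [← Equiv.Perm.mul_apply, ← Subgroup.coe_mul, mul_inv_cancel] at this
    exact this.symm

instance finiteIndex_deckGroup [Finite I] [∀ i, Finite (G i)] :
    (deckGroup Γ G C₀).FiniteIndex := by
  choose h hh using fun g : liftGroup Γ G C₀ => g.2.2
  suffices Finite (liftGroup Γ G C₀ ⧸ deckGroup Γ G C₀) from
    Subgroup.finiteIndex_of_finite_quotient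
  -- Two lifts covering the same `h` differ by a deck transformation; `h` is a mere choice and need
  -- not be multiplicative.
  refine Finite.of_injective (fun q : liftGroup Γ G C₀ ⧸ deckGroup Γ G C₀ => h q.out) ?_
  intro q q' hqq
  rw [← q.out_eq', ← q'.out_eq']
  refine QuotientGroup.eq.2 fun x => funext fun i => ?_
  simp only at hqq
  generalize q.out = g at *
  generalize q'.out = g' at *
  have h1 := hh g ((g⁻¹ * g').1 x) i
  rw [← Equiv.Perm.mul_apply, ← Subgroup.coe_mul, mul_inv_cancel_left, hh g' x i, hqq] at h1
  exact (MulAction.injective _ h1).symm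

open GraphProduct in
theorem residuallyFinite_liftGroup [Finite I] [∀ i, Finite (X i)] [∀ i, Finite (G i)] :
    Group.ResiduallyFinite (liftGroup Γ G C₀) := by
  classical
  cases nonempty_fintype I
  have hne : ∀ i, Nonempty (CommGroup (X i)) := fun i =>
    have : Nonempty (X i) := ⟨C₀ i⟩
    nonempty_commGroup_of_finite (X i)
  let : ∀ i, CommGroup (X i) := fun i => (hne i).some
  have key : ∀ (n : deckGroup Γ G C₀) (w : GroupGraphProduct Γ X) (x : GraphProduct Γ C₀),
      n.1.1 (act Γ C₀ w x) = act Γ C₀ w (n.1.1 x) := fun n =>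
    map_act (fun i x y => (n.1.2.1 i x y).1) n.2
  let f : deckGroup Γ G C₀ →* GroupGraphProduct Γ X :=
    -- Since `n` commutes with the action, the label of `n * m` is that of `m` times that of `n`;
    -- the inverse restores the order.
    MonoidHom.mk' (fun n => (classLabel (n.1.1 (base Γ C₀)).2)⁻¹) fun n m => by
      rw [← mul_inv_rev, ← classLabel_act, ← key, act_classLabel]
      rfl
  refine .of_finiteIndex_of_injective (deckGroup Γ G C₀) f fun n m hnm => ?_
  have hb : n.1.1 (base Γ C₀) = m.1.1 (base Γ C₀) := by
    rw [← act_classLabel (n.1.1 (base Γ C₀)), inv_injective hnm, act_classLabel]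
  refine Subtype.ext (Subtype.ext (Equiv.ext fun x => ?_))
  rw [← act_classLabel x, key, key, hb]

end LiftGroup

/-! ### The generalized graph product of groups -/

section PartialStabilizer

variable {I : Type*} {X : I → Type*} {G : I → Type*} [∀ i, Group (G i)]
  [∀ i, MulAction (G i) (X i)] {C : ∀ i, X i}

theorem partialStabilizer_mono {T T' : Set I} (h : T ⊆ T') :
    partialStabilizer G C T ≤ partialStabilizer G C T' :=
  fun _ hg i hi => hg i fun hi' => hi (h hi')

theorem mem_partialStabilizer_empty {T : Set I} {g : ∀ i, G i} (hg : g ∈ partialStabilizer G C T)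
    (hT : ∀ i ∈ T, g i ∈ MulAction.stabilizer (G i) (C i)) : g ∈ partialStabilizer G C ∅ := by
  intro i _
  by_cases hi : i ∈ T
  · exact hT i hi
  · exact hg i hi

theorem mulSingle_mem_partialStabilizer [DecidableEq I] {T : Set I} {i : I} (hi : i ∈ T)
    (c : G i) : Pi.mulSingle i c ∈ partialStabilizer G C T := by
  intro j hj
  rw [Pi.mulSingle_eq_of_ne (show j ≠ i from fun h => hj (h ▸ hi))]
  exact one_mem _

end PartialStabilizer

/-- The empty set, the vertices and the edges of a graph. -/
def IsSmallClique {I : Type*} (Γ : SimpleGraph I) (T : Set I) : Prop :=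
  T = ∅ ∨ (∃ i, T = {i}) ∨ ∃ i j, Γ.Adj i j ∧ T = {i, j}

namespace IsSmallClique

variable {I : Type*} {Γ : SimpleGraph I}

theorem empty : IsSmallClique Γ ∅ := Or.inl rfl

theorem vertex (i : I) : IsSmallClique Γ {i} := Or.inr (Or.inl ⟨i, rfl⟩)

theorem edge {i j : I} (h : Γ.Adj i j) : IsSmallClique Γ {i, j} := Or.inr (Or.inr ⟨i, j, h, rfl⟩)

theorem pairwise_adj {T : Set I} (hT : IsSmallClique Γ T) : T.Pairwise Γ.Adj := by
  obtain rfl | ⟨i, rfl⟩ | ⟨i, j, h, rfl⟩ := hT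
  · exact Set.pairwise_empty _
  · exact Set.pairwise_singleton _ _
  · exact Set.pairwise_pair.2 fun _ => ⟨h, h.symm⟩

end IsSmallClique

namespace GeneralizedGraphProduct

section Basic

variable {I : Type*} {Γ : SimpleGraph I} {X : I → Type*} {G : I → Type*} [∀ i, Group (G i)]
  [∀ i, MulAction (G i) (X i)] {C : ∀ i, X i}

variable (Γ G C) in
/-- The projection of the free product onto the generalized graph product. -/
def mk : (Monoid.CoprodI fun T : SmallClique Γ => partialStabilizer G C T.1) →*
    GeneralizedGraphProduct Γ G C :=
  QuotientGroup.mk' (Subgroup.normalClosure (inclusionRelations Γ G C))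

theorem mk_surjective : Function.Surjective (mk Γ G C) :=
  QuotientGroup.mk_surjective

/-- The homomorphisms from the groups of the diagram to the direct limit. -/
def incl {T : Set I} (hT : IsSmallClique Γ T) :
    partialStabilizer G C T →* GeneralizedGraphProduct Γ G C :=
  (mk Γ G C).comp
    (Monoid.CoprodI.of (M := fun T : SmallClique Γ => partialStabilizer G C T.1) (i := ⟨T, hT⟩))

theorem incl_eq_of_subset {T T' : Set I} (hT : IsSmallClique Γ T) (hT' : IsSmallClique Γ T')
    (h : T ⊆ T') {g : partialStabilizer G C T} {g' : partialStabilizer G C T'}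
    (hg : (g : ∀ i, G i) = g') : incl hT g = incl hT' g' := by
  rw [← mul_inv_eq_one, incl, incl, MonoidHom.comp_apply, MonoidHom.comp_apply, ← map_inv,
    ← map_mul]
  exact (QuotientGroup.eq_one_iff _).2
    (Subgroup.subset_normalClosure ⟨⟨T, hT⟩, ⟨T', hT'⟩, g, g', h, hg, rfl⟩)

theorem commute_incl {T T' U : Set I} (hT : IsSmallClique Γ T) (hT' : IsSmallClique Γ T')
    (hU : IsSmallClique Γ U) (h : T ⊆ U) (h' : T' ⊆ U)
    {g : partialStabilizer G C T} {g' : partialStabilizer G C T'}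
    (hg : Commute (g : ∀ i, G i) g') : Commute (incl hT g) (incl hT' g') := by
  rw [incl_eq_of_subset hT hU h (g' := ⟨g, partialStabilizer_mono h g.2⟩) rfl,
    incl_eq_of_subset hT' hU h' (g' := ⟨g', partialStabilizer_mono h' g'.2⟩) rfl]
  exact Commute.map (show Commute (⟨g, _⟩ : partialStabilizer G C U) ⟨g', _⟩ from
    Subtype.ext hg.eq) (incl hU)

/-- The universal property of the direct limit. -/
def lift {H : Type*} [Group H]
    (f : ∀ T : Set I, IsSmallClique Γ T → (partialStabilizer G C T →* H))
    (hf : ∀ (T T' : Set I) (hT : IsSmallClique Γ T) (hT' : IsSmallClique Γ T')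
      (g : partialStabilizer G C T) (g' : partialStabilizer G C T'), T ⊆ T' →
      (g : ∀ i, G i) = g' → f T hT g = f T' hT' g') :
    GeneralizedGraphProduct Γ G C →* H :=
  QuotientGroup.lift _ (Monoid.CoprodI.lift fun T : SmallClique Γ => f T.1 T.2) <| by
    refine Subgroup.normalClosure_le_normal
      (N := (Monoid.CoprodI.lift fun T : SmallClique Γ => f T.1 T.2).ker) ?_
    rintro _ ⟨T, T', g, g', h, hg, rfl⟩
    rw [SetLike.mem_coe, MonoidHom.mem_ker, map_mul, map_inv, mul_inv_eq_one,
      Monoid.CoprodI.lift_of, Monoid.CoprodI.lift_of]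
    exact hf _ _ T.2 T'.2 g g' h hg

theorem lift_incl {H : Type*} [Group H]
    (f : ∀ T : Set I, IsSmallClique Γ T → (partialStabilizer G C T →* H))
    (hf : ∀ (T T' : Set I) (hT : IsSmallClique Γ T) (hT' : IsSmallClique Γ T')
      (g : partialStabilizer G C T) (g' : partialStabilizer G C T'), T ⊆ T' →
      (g : ∀ i, G i) = g' → f T hT g = f T' hT' g')
    {T : Set I} (hT : IsSmallClique Γ T) (g : partialStabilizer G C T) :
    lift f hf (incl hT g) = f T hT g :=
  Monoid.CoprodI.lift_of (fun T : SmallClique Γ => f T.1 T.2) (i := ⟨T, hT⟩) g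

@[elab_as_elim]
theorem induction_on {motive : GeneralizedGraphProduct Γ G C → Prop}
    (x : GeneralizedGraphProduct Γ G C) (one : motive 1)
    (incl : ∀ (T : Set I) (hT : IsSmallClique Γ T) g, motive (incl hT g))
    (mul : ∀ x y, motive x → motive y → motive (x * y)) : motive x := by
  obtain ⟨x, rfl⟩ := mk_surjective x
  induction x using Monoid.CoprodI.induction_on with
  | one => exact one
  | of T g => exact incl T.1 T.2 g
  | mul x y hx hy =>
    rw [map_mul]
    exact mul _ _ hx hy

variable (Γ G C) in
/-- The projection onto the product of the groups. -/
def proj : GeneralizedGraphProduct Γ G C →* ∀ i, G i :=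
  lift (fun T _ => (partialStabilizer G C T).subtype) fun _ _ _ _ _ _ _ h => h

theorem proj_incl {T : Set I} (hT : IsSmallClique Γ T) (g : partialStabilizer G C T) :
    proj Γ G C (incl hT g) = g :=
  lift_incl (fun T _ => (partialStabilizer G C T).subtype) _ hT g

theorem incl_eq_incl_empty {T : Set I} (hT : IsSmallClique Γ T) (g : partialStabilizer G C T)
    (hg : ∀ i ∈ T, (g : ∀ i, G i) i = 1) : ∃ b, incl hT g = incl .empty b :=
  ⟨⟨g, mem_partialStabilizer_empty g.2 fun i hi => by rw [hg i hi]; exact one_mem _⟩,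
    (incl_eq_of_subset .empty hT (Set.empty_subset _) rfl).symm⟩

variable [DecidableEq I]

variable (Γ G C) in
/-- The homomorphism from a single factor to the direct limit. -/
def single (i : I) : G i →* GeneralizedGraphProduct Γ G C :=
  (incl (IsSmallClique.vertex i)).comp
    ((MonoidHom.mulSingle G i).codRestrict (partialStabilizer G C {i})
      (mulSingle_mem_partialStabilizer (Set.mem_singleton i)))

theorem single_eq_incl {T : Set I} (hT : IsSmallClique Γ T) {i : I} (hi : i ∈ T) (c : G i) :
    single Γ G C i c = incl hT ⟨Pi.mulSingle i c, mulSingle_mem_partialStabilizer hi c⟩ :=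
  incl_eq_of_subset _ _ (Set.singleton_subset_iff.2 hi) rfl

theorem proj_single (i : I) (c : G i) : proj Γ G C (single Γ G C i c) = Pi.mulSingle i c :=
  proj_incl _ _

theorem commute_single {i j : I} (h : Γ.Adj i j) (c : G i) (d : G j) :
    Commute (single Γ G C i c) (single Γ G C j d) := by
  rw [single_eq_incl (.edge h) (Set.mem_insert i _),
    single_eq_incl (.edge h) (Set.mem_insert_of_mem i rfl)]
  exact commute_incl _ _ (.edge h) subset_rfl subset_rfl (Pi.mulSingle_commute h.ne c d)

theorem commute_single_incl {i : I} (c : G i) {b : partialStabilizer G C ∅}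
    (hb : (b : ∀ i, G i) i = 1) : Commute (single Γ G C i c) (incl .empty b) := by
  rw [single_eq_incl (.vertex i) rfl]
  refine commute_incl _ _ (.vertex i) subset_rfl (Set.empty_subset _) (funext fun j => ?_)
  rcases eq_or_ne j i with rfl | hj
  · simp [hb]
  · simp [hj]

theorem incl_eq_single_mul {T : Set I} (hT : IsSmallClique Γ T) {i : I} (hi : i ∈ T)
    (g : partialStabilizer G C T) :
    incl hT g = single Γ G C i ((g : ∀ i, G i) i) *
      incl hT
        (⟨Pi.mulSingle i ((g : ∀ i, G i) i), mulSingle_mem_partialStabilizer hi _⟩⁻¹ * g) := by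
  rw [single_eq_incl hT hi, ← map_mul, mul_inv_cancel_left]

@[elab_as_elim]
-- The coordinates in `T` can be split off one at a time, and what remains stabilizes every `C i`.
theorem induction_single {motive : GeneralizedGraphProduct Γ G C → Prop}
    (x : GeneralizedGraphProduct Γ G C) (one : motive 1)
    (single : ∀ i c, motive (single Γ G C i c)) (incl : ∀ b, motive (incl .empty b))
    (mul : ∀ x y, motive x → motive y → motive (x * y)) : motive x := by
  induction x using induction_on with
  | one => exact one
  | mul x y hx hy => exact mul x y hx hy
  | incl T hT g =>
    have key : ∀ g : partialStabilizer G C T, (∀ i ∈ T, (g : ∀ i, G i) i = 1) →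
        motive (GeneralizedGraphProduct.incl hT g) := fun g hg => by
      obtain ⟨b, hb⟩ := incl_eq_incl_empty hT g hg
      exact hb ▸ incl b
    obtain rfl | ⟨i, rfl⟩ | ⟨i, j, h, rfl⟩ := id hT
    · exact incl g
    · rw [incl_eq_single_mul hT (Set.mem_singleton i)]
      refine mul _ _ (single _ _) (key _ ?_)
      rintro _ rfl
      simp
    · rw [incl_eq_single_mul hT (Set.mem_insert i _)]
      refine mul _ _ (single _ _) ?_
      rw [incl_eq_single_mul hT (Set.mem_insert_of_mem i rfl)]
      refine mul _ _ (single _ _) (key _ ?_)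
      rintro _ (rfl | rfl)
      · simp [h.ne]
      · simp

end Basic

/-! ### The action on cosets -/

section Coset

open GroupGraphProduct

variable {I : Type*} [DecidableEq I] {Γ : SimpleGraph I} {X : I → Type*} {G : I → Type*}
  [∀ i, Group (G i)] [∀ i, MulAction (G i) (X i)] {C : ∀ i, X i}

variable (C) in
/-- The image of `C` under `h`. -/
def orbitPoint (h : ∀ i, G i) (i : I) : MulAction.orbit (G i) (C i) :=
  ⟨h i • C i, MulAction.mem_orbit _ _⟩

omit [DecidableEq I] in
theorem orbitPoint_mul_apply {h b : ∀ i, G i} {i : I}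
    (hb : b i ∈ MulAction.stabilizer (G i) (C i)) :
    orbitPoint C (h * b) i = orbitPoint C h i :=
  Subtype.ext <| by
    simp only [orbitPoint, Pi.mul_apply, mul_smul]
    rw [hb]

variable (Γ G C) in
/-- The subgroup of the direct limit that fixes the base chamber. -/
def baseGroup : Subgroup (GeneralizedGraphProduct Γ G C) :=
  (incl (IsSmallClique.empty (Γ := Γ))).range

theorem single_mem_baseGroup {i : I} {c : G i} (hc : c ∈ MulAction.stabilizer (G i) (C i)) :
    single Γ G C i c ∈ baseGroup Γ G C := by
  refine ⟨⟨Pi.mulSingle i c, fun j _ => ?_⟩, incl_eq_of_subset _ _ (Set.empty_subset _) rfl⟩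
  rcases eq_or_ne j i with rfl | hj
  · rwa [Pi.mulSingle_eq_same]
  · rw [Pi.mulSingle_eq_of_ne hj]
    exact one_mem _

/-- An element that moves the base point to a given point of its orbit. -/
noncomputable def transporter {i : I} (x : MulAction.orbit (G i) (C i)) : G i :=
  (MulAction.mem_orbit_iff.1 x.2).choose

omit [DecidableEq I] in
theorem transporter_smul {i : I} (x : MulAction.orbit (G i) (C i)) :
    transporter x • C i = x :=
  (MulAction.mem_orbit_iff.1 x.2).choose_spec

/-- Change the `i`-th coordinate of the chamber of `g` to `x`. -/
noncomputable def replace (i : I) (x : MulAction.orbit (G i) (C i))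
    (g : GeneralizedGraphProduct Γ G C) : GeneralizedGraphProduct Γ G C :=
  g * single Γ G C i ((proj Γ G C g i)⁻¹ * transporter x)

/-- Write `g' = g * b` and split `b` into its `i`-th coordinate and a part `b'` trivial at `i`. The
former cancels against the change in `proj`; the latter commutes with the factor at `i` and ends up
on the right. -/
theorem mk_replace_eq (i : I) (x : MulAction.orbit (G i) (C i))
    {g g' : GeneralizedGraphProduct Γ G C} (h : g⁻¹ * g' ∈ baseGroup Γ G C) :
    (replace i x g : GeneralizedGraphProduct Γ G C ⧸ baseGroup Γ G C) = replace i x g' := by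
  obtain ⟨b, hb⟩ := h
  obtain rfl : g' = g * incl .empty b := by rw [hb, mul_inv_cancel_left]
  have hmem : Pi.mulSingle i ((b : ∀ i, G i) i) ∈ partialStabilizer G C ∅ := by
    intro j _
    rcases eq_or_ne j i with rfl | hj
    · rw [Pi.mulSingle_eq_same]
      exact b.2 j (Set.notMem_empty j)
    · rw [Pi.mulSingle_eq_of_ne hj]
      exact one_mem _
  obtain ⟨b', hb'⟩ : ∃ b' : partialStabilizer G C ∅, b' = b * ⟨_, hmem⟩⁻¹ := ⟨_, rfl⟩
  have hbb : incl .empty b = incl .empty b' * single Γ G C i ((b : ∀ i, G i) i) := by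
    have : single Γ G C i ((b : ∀ i, G i) i) = incl .empty ⟨_, hmem⟩ :=
      (incl_eq_of_subset .empty (.vertex i) (Set.empty_subset _) rfl).symm
    rw [this, ← map_mul, hb', inv_mul_cancel_right]
  have hc : ∀ c, Commute (single Γ G C i c) (incl .empty b') := fun c =>
    commute_single_incl c (by simp [hb'])
  have hp : proj Γ G C (g * incl .empty b) i = proj Γ G C g i * (b : ∀ i, G i) i := by
    rw [map_mul, proj_incl, Pi.mul_apply]
  refine QuotientGroup.eq.2 ⟨b', ?_⟩
  rw [replace, replace, hp, eq_inv_mul_iff_mul_eq, hbb, mul_inv_rev, mul_assoc _⁻¹,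
    map_mul (single Γ G C i) ((b : ∀ i, G i) i)⁻¹, map_inv (single Γ G C i) ((b : ∀ i, G i) i),
    mul_assoc g, (hc _).eq]
  group

theorem proj_replace_self (i : I) (x : MulAction.orbit (G i) (C i))
    (g : GeneralizedGraphProduct Γ G C) : proj Γ G C (replace i x g) i = transporter x := by
  simp [replace, proj_single]

theorem proj_replace_of_ne {i j : I} (h : j ≠ i) (x : MulAction.orbit (G i) (C i))
    (g : GeneralizedGraphProduct Γ G C) : proj Γ G C (replace i x g) j = proj Γ G C g j := by
  simp [replace, proj_single, h]

theorem orbitPoint_replace_self (i : I) (x : MulAction.orbit (G i) (C i))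
    (g : GeneralizedGraphProduct Γ G C) : orbitPoint C (proj Γ G C (replace i x g)) i = x :=
  Subtype.ext <| by
    simp only [orbitPoint, proj_replace_self]
    exact transporter_smul x

theorem orbitPoint_replace_of_ne {i j : I} (h : j ≠ i) (x : MulAction.orbit (G i) (C i))
    (g : GeneralizedGraphProduct Γ G C) :
    orbitPoint C (proj Γ G C (replace i x g)) j = orbitPoint C (proj Γ G C g) j := by
  simp only [orbitPoint, proj_replace_of_ne h]

theorem replace_replace (i : I) (x y : MulAction.orbit (G i) (C i))
    (g : GeneralizedGraphProduct Γ G C) : replace i x (replace i y g) = replace i x g := by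
  rw [replace, proj_replace_self, replace, replace, mul_assoc, ← map_mul]
  group

/-- The chosen transporter and the actual coordinate differ by a stabilizer element, so on cosets
right multiplication by a factor is a replacement. -/
theorem mk_replace_mul_single (i : I) (c : G i) (g : GeneralizedGraphProduct Γ G C) :
    (replace i (orbitPoint C (proj Γ G C (g * single Γ G C i c)) i) g :
      GeneralizedGraphProduct Γ G C ⧸ baseGroup Γ G C) = (g * single Γ G C i c : _) := by
  refine (QuotientGroup.eq.2 ?_).symm
  rw [replace, mul_inv_rev, mul_assoc, inv_mul_cancel_left, ← map_inv, ← map_mul]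
  refine single_mem_baseGroup ?_
  rw [MulAction.mem_stabilizer_iff, mul_smul, mul_smul, transporter_smul]
  simp [orbitPoint, proj_single, mul_smul]

theorem replace_comm {i j : I} (h : Γ.Adj i j) (x : MulAction.orbit (G i) (C i))
    (y : MulAction.orbit (G j) (C j)) (g : GeneralizedGraphProduct Γ G C) :
    replace i x (replace j y g) = replace j y (replace i x g) := by
  rw [replace, proj_replace_of_ne h.ne, replace, replace, proj_replace_of_ne h.ne', replace,
    mul_assoc, mul_assoc, (commute_single h _ _).eq]

variable [∀ i, CommGroup (MulAction.orbit (G i) (C i))]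

/-- Multiply the `i`-th coordinate of the chamber of a coset by `a`. -/
noncomputable def cosetMove (i : I) (a : MulAction.orbit (G i) (C i)) :
    GeneralizedGraphProduct Γ G C ⧸ baseGroup Γ G C →
      GeneralizedGraphProduct Γ G C ⧸ baseGroup Γ G C :=
  Quotient.lift (fun g => (replace i (a * orbitPoint C (proj Γ G C g) i) g : _ ⧸ _))
    fun g g' h => by
      have h' : g⁻¹ * g' ∈ baseGroup Γ G C := QuotientGroup.leftRel_apply.1 h
      obtain ⟨b, hb⟩ := h'
      have : orbitPoint C (proj Γ G C g') i = orbitPoint C (proj Γ G C g) i := by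
        rw [← mul_inv_cancel_left g g', ← hb, map_mul, proj_incl,
          orbitPoint_mul_apply (b.2 i (Set.notMem_empty i))]
      rw [this]
      exact mk_replace_eq i _ ⟨b, hb⟩

theorem cosetMove_mk (i : I) (a : MulAction.orbit (G i) (C i))
    (g : GeneralizedGraphProduct Γ G C) :
    cosetMove i a (g : GeneralizedGraphProduct Γ G C ⧸ baseGroup Γ G C) =
      (replace i (a * orbitPoint C (proj Γ G C g) i) g : _) :=
  rfl

theorem cosetMove_one (i : I) (q : GeneralizedGraphProduct Γ G C ⧸ baseGroup Γ G C) :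
    cosetMove i 1 q = q := by
  obtain ⟨g, rfl⟩ := QuotientGroup.mk_surjective q
  have := mk_replace_mul_single i 1 g
  rw [map_one, mul_one] at this
  rw [cosetMove_mk, one_mul, this]

theorem cosetMove_mul (i : I) (a b : MulAction.orbit (G i) (C i))
    (q : GeneralizedGraphProduct Γ G C ⧸ baseGroup Γ G C) :
    cosetMove i (a * b) q = cosetMove i a (cosetMove i b q) := by
  obtain ⟨g, rfl⟩ := QuotientGroup.mk_surjective q
  rw [cosetMove_mk, cosetMove_mk, cosetMove_mk, orbitPoint_replace_self, replace_replace,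
    mul_assoc]

theorem cosetMove_comm {i j : I} (h : Γ.Adj i j) (a : MulAction.orbit (G i) (C i))
    (b : MulAction.orbit (G j) (C j)) (q : GeneralizedGraphProduct Γ G C ⧸ baseGroup Γ G C) :
    cosetMove i a (cosetMove j b q) = cosetMove j b (cosetMove i a q) := by
  obtain ⟨g, rfl⟩ := QuotientGroup.mk_surjective q
  rw [cosetMove_mk, cosetMove_mk, cosetMove_mk, cosetMove_mk, orbitPoint_replace_of_ne h.ne,
    orbitPoint_replace_of_ne h.ne', replace_comm h]

variable (Γ G C) in
/-- The action of the graph product of the orbits on the cosets of the base group. -/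
noncomputable def cosetAct : GroupGraphProduct Γ (fun i => MulAction.orbit (G i) (C i)) →*
    Equiv.Perm (GeneralizedGraphProduct Γ G C ⧸ baseGroup Γ G C) :=
  GroupGraphProduct.lift (fun i =>
    letI : MulAction (MulAction.orbit (G i) (C i))
        (GeneralizedGraphProduct Γ G C ⧸ baseGroup Γ G C) :=
      { smul := cosetMove i, one_smul := cosetMove_one i, mul_smul := cosetMove_mul i }
    MulAction.toPermHom (MulAction.orbit (G i) (C i))
      (GeneralizedGraphProduct Γ G C ⧸ baseGroup Γ G C))
    fun _ _ h a b => Equiv.ext fun q => cosetMove_comm h a b q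

theorem cosetAct_of (i : I) (a : MulAction.orbit (G i) (C i))
    (q : GeneralizedGraphProduct Γ G C ⧸ baseGroup Γ G C) :
    cosetAct Γ G C (of Γ i a) q = cosetMove i a q :=
  DFunLike.congr_fun (GroupGraphProduct.lift_of
    (X := fun i => MulAction.orbit (G i) (C i)) _ _ i a) q

end Coset

/-! ### The action induced from the action on chambers -/

section Translate

open GroupGraphProduct

variable {I : Type*} [Fintype I] {Γ : SimpleGraph I} {X : I → Type*} {G : I → Type*}
  [∀ i, Group (G i)] [∀ i, MulAction (G i) (X i)] {C : ∀ i, X i}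
  [∀ i, CommGroup (MulAction.orbit (G i) (C i))]

variable (Γ C) in
/-- Right translation by `g⁻¹` of `h ∈ ∏ i, G i`, together with the element of the graph product
that describes a path from the image of `C` under `h` to its image under `h * g⁻¹`. -/
noncomputable def translate (g : ∀ i, G i)
    (p : GroupGraphProduct Γ (fun i => MulAction.orbit (G i) (C i)) × ∀ i, G i) :
    GroupGraphProduct Γ (fun i => MulAction.orbit (G i) (C i)) × ∀ i, G i :=
  (orderedProd Γ (orbitPoint C (p.2 * g⁻¹) / orbitPoint C p.2) * p.1, p.2 * g⁻¹)

theorem translate_one (p : GroupGraphProduct Γ (fun i => MulAction.orbit (G i) (C i)) × ∀ i, G i) :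
    translate Γ C 1 p = p := by
  rw [translate, inv_one, mul_one, div_self', orderedProd_one, one_mul]

/-- Both labels are supported on the clique `T`, hence telescope. The argument needs a common `T`,
so it yields actions of the groups `H_T`, which glue over the direct limit. -/
theorem translate_mul {T : Set I} (hT : T.Pairwise Γ.Adj) {g g' : ∀ i, G i}
    (hg : g ∈ partialStabilizer G C T) (hg' : g' ∈ partialStabilizer G C T)
    (p : GroupGraphProduct Γ (fun i => MulAction.orbit (G i) (C i)) × ∀ i, G i) :
    translate Γ C (g * g') p = translate Γ C g (translate Γ C g' p) := by
  have key : ∀ {g}, g ∈ partialStabilizer G C T → ∀ h : ∀ i, G i, ∀ i, i ∉ T →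
      (orbitPoint C (h * g⁻¹) / orbitPoint C h) i = 1 := fun {g} hg h i hi => by
    rw [Pi.div_apply, div_eq_one]
    exact orbitPoint_mul_apply (inv_mem hg i hi)
  simp only [translate]
  rw [← mul_assoc (orderedProd Γ _), ← orderedProd_mul hT (key hg _) (key hg' _),
    div_mul_div_cancel, mul_inv_rev, mul_assoc p.2]

variable (Γ G C) in
/-- The action of the generalized graph product by translations. -/
noncomputable def translateHom : GeneralizedGraphProduct Γ G C →*
    Equiv.Perm (GroupGraphProduct Γ (fun i => MulAction.orbit (G i) (C i)) × ∀ i, G i) :=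
  lift (fun T hT =>
    letI : MulAction (partialStabilizer G C T)
        (GroupGraphProduct Γ (fun i => MulAction.orbit (G i) (C i)) × ∀ i, G i) :=
      { smul := fun g => translate Γ C g.1
        one_smul := translate_one
        mul_smul := fun g g' => translate_mul hT.pairwise_adj g.2 g'.2 }
    MulAction.toPermHom (partialStabilizer G C T)
      (GroupGraphProduct Γ (fun i => MulAction.orbit (G i) (C i)) × ∀ i, G i))
    fun _ _ _ _ _ _ _ h => Equiv.ext fun p => congrArg (fun g => translate Γ C g p) h

theorem translateHom_incl {T : Set I} (hT : IsSmallClique Γ T) (g : partialStabilizer G C T)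
    (p : GroupGraphProduct Γ (fun i => MulAction.orbit (G i) (C i)) × ∀ i, G i) :
    translateHom Γ G C (incl hT g) p = translate Γ C g.1 p :=
  congrArg (fun e : Equiv.Perm _ => e p) (lift_incl _ _ hT g)

/-- Labels are multiplied on the left, so translations commute with right multiplication. On the
kernel of `proj` this makes the label a homomorphism. -/
theorem translateHom_apply (x : GeneralizedGraphProduct Γ G C)
    (z w : GroupGraphProduct Γ (fun i => MulAction.orbit (G i) (C i))) (h : ∀ i, G i) :
    translateHom Γ G C x (z * w, h) =
      ((translateHom Γ G C x (z, h)).1 * w, h * (proj Γ G C x)⁻¹) := by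
  induction x using induction_on generalizing z w h with
  | one => simp
  | incl T hT g => simp only [translateHom_incl, translate, proj_incl, mul_assoc]
  | mul x y hx hy =>
    have hy1 := hy z 1 h
    rw [mul_one, mul_one] at hy1
    rw [map_mul, Equiv.Perm.mul_apply, Equiv.Perm.mul_apply, hy, hx]
    have h2 : translateHom Γ G C y (z, h) =
      ((translateHom Γ G C y (z, h)).1, h * (proj Γ G C y)⁻¹) := hy1
    rw [← h2, map_mul, mul_inv_rev, mul_assoc]

/-- The label really leads from the base coset to that of `g * x⁻¹`. It suffices to check single
factors, which act by coset moves, and `H_∅`, which changes neither coset nor label. -/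
theorem cosetAct_translateHom [DecidableEq I] (x : GeneralizedGraphProduct Γ G C)
    (z : GroupGraphProduct Γ (fun i => MulAction.orbit (G i) (C i)))
    (g : GeneralizedGraphProduct Γ G C)
    (hz : cosetAct Γ G C z ((1 : GeneralizedGraphProduct Γ G C) : _ ⧸ _) = (g : _ ⧸ _)) :
    cosetAct Γ G C (translateHom Γ G C x (z, proj Γ G C g)).1
      ((1 : GeneralizedGraphProduct Γ G C) : _ ⧸ _) = ((g * x⁻¹ : _) : _ ⧸ _) := by
  induction x using induction_single generalizing z g with
  | one => simpa using hz
  | single i c =>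
    have h1 : ∀ j, j ≠ i → (orbitPoint C (proj Γ G C g * (Pi.mulSingle i c)⁻¹) /
        orbitPoint C (proj Γ G C g)) j = 1 := fun j hj => by
      rw [Pi.div_apply, div_eq_one]
      refine orbitPoint_mul_apply ?_
      rw [Pi.inv_apply, Pi.mulSingle_eq_of_ne hj, inv_one]
      exact one_mem _
    rw [single_eq_incl (.vertex i) (Set.mem_singleton i), translateHom_incl]
    simp only [translate]
    rw [orderedProd_of_eq_one h1, map_mul, Equiv.Perm.mul_apply, hz, cosetAct_of, cosetMove_mk,
      Pi.div_apply, div_mul_cancel, ← single_eq_incl (.vertex i) (Set.mem_singleton i), ← map_inv]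
    have h2 := mk_replace_mul_single i c⁻¹ g
    rwa [map_mul, proj_single, Pi.mulSingle_inv] at h2
  | incl b =>
    rw [translateHom_incl]
    simp only [translate]
    have h1 : orbitPoint C (proj Γ G C g * (b : ∀ i, G i)⁻¹) = orbitPoint C (proj Γ G C g) :=
      funext fun i => orbitPoint_mul_apply (inv_mem b.2 i (Set.notMem_empty i))
    rw [h1, div_self', orderedProd_one, one_mul, hz]
    refine QuotientGroup.eq.2 ?_
    rw [inv_mul_cancel_left]
    exact inv_mem ⟨b, rfl⟩
  | mul x y hx hy =>
    have h2 : translateHom Γ G C y (z, proj Γ G C g) =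
        ((translateHom Γ G C y (z, proj Γ G C g)).1, proj Γ G C (g * y⁻¹)) := by
      have := translateHom_apply y z 1 (proj Γ G C g)
      rwa [mul_one, mul_one, ← map_inv, ← map_mul] at this
    rw [map_mul, Equiv.Perm.mul_apply, h2, hx _ _ (hy z g hz), mul_inv_rev, mul_assoc]

end Translate

instance residuallyFinite {I : Type*} [Finite I] (Γ : SimpleGraph I) {X : I → Type*}
    (G : I → Type*) [∀ i, Group (G i)] [∀ i, MulAction (G i) (X i)] [∀ i, Finite (G i)]
    (C : ∀ i, X i) : Group.ResiduallyFinite (GeneralizedGraphProduct Γ G C) := by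
  classical
  cases nonempty_fintype I
  have hfin : ∀ i, Finite (MulAction.orbit (G i) (C i)) := fun i => Set.finite_range _
  let : ∀ i, CommGroup (MulAction.orbit (G i) (C i)) := fun i =>
    have : Nonempty (MulAction.orbit (G i) (C i)) := ⟨⟨C i, MulAction.mem_orbit_self _⟩⟩
    (nonempty_commGroup_of_finite _).some
  let f : (proj Γ G C).ker →* GroupGraphProduct Γ (fun i => MulAction.orbit (G i) (C i)) :=
    MonoidHom.mk' (fun x => (translateHom Γ G C x (1, 1)).1) fun x y => by
      have hy := translateHom_apply y.1 1 1 1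
      rw [mul_one, mul_one, MonoidHom.mem_ker.1 y.2, inv_one, mul_one] at hy
      have hx := translateHom_apply x.1 1 (translateHom Γ G C y.1 (1, 1)).1 1
      rw [one_mul] at hx
      rw [Subgroup.coe_mul, map_mul, Equiv.Perm.mul_apply, hy, hx]
  have : (proj Γ G C).ker.FiniteIndex := Subgroup.finiteIndex_ker _
  refine .of_finiteIndex_of_injective _ f ((injective_iff_map_eq_one f).2 fun x hx => ?_)
  have h1 := cosetAct_translateHom x.1 1 1 (by rw [map_one, Equiv.Perm.one_apply])
  have h2 : (translateHom Γ G C x.1 (1, proj Γ G C 1)).1 = 1 := by rw [map_one]; exact hx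
  -- A trivial label means that `x⁻¹` fixes the base coset, so it comes from some `b` in `H_∅`; the
  -- projection then shows `b = 1`.
  rw [h2, map_one, Equiv.Perm.one_apply, QuotientGroup.eq] at h1
  obtain ⟨b, hb⟩ := h1
  rw [inv_one, one_mul, one_mul] at hb
  have hb1 : (b : ∀ i, G i) = 1 := by
    rw [← proj_incl (Γ := Γ) .empty b, hb, map_inv, MonoidHom.mem_ker.1 x.2, inv_one]
  refine Subtype.ext (inv_injective ?_)
  have hb2 : b = 1 := Subtype.ext hb1
  rw [← hb, hb2, map_one, Subgroup.coe_one, inv_one]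

end GeneralizedGraphProduct

theorem mainTheorem8 {I : Type*} [Finite I] (Γ : SimpleGraph I)
    {S : I → Type*} (M : ∀ i, CoxeterMatrix (S i))
    {W : I → Type*} [∀ i, Group (W i)] (cs : ∀ i, CoxeterSystem (M i) (W i))
    {Δ : I → Type*} [∀ i, Finite (Δ i)] (δ : ∀ i, Δ i → Δ i → W i)
    (hδ : ∀ i, IsBuilding (cs i) (δ i)) (C₀ : ∀ i, Δ i) :
    Group.ResiduallyFinite (liftGroup Γ (fun i => buildingAut (cs i) (δ i)) C₀) ∧
      Group.ResiduallyFinite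
        (GeneralizedGraphProduct Γ (fun i => buildingAut (cs i) (δ i)) C₀) :=
  ⟨residuallyFinite_liftGroup, inferInstance⟩
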